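/- Let $0<q<1$. Write $(a;q)_n=\prod_{k=0}^{n-1}(1-aq^k)$, $(a;q)_\infty=\prod_{k\ge 0}(1-aq^k)$, $\Gamma_q(x)=(1-q)^{1-x}\,\dfrac{(q;q)_\infty}{(q^x;q)_\infty}$ (so that $\Gamma_{q^2}$ is the $q$-gamma function with base $q^2$), and $(a)_n=a(a+1)\cdots(a+n-1)$. Put \[P_1(n)=q^{4n} + 9 q^{2n+1} + 36 q^{4n+2} - 7 q^{6n+1} + 84 q^{6n+3} - 63 q^{8n+2} + 126 q^{8n+4} - 231 q^{10n+3} + 126 q^{10n+5} + 35 q^{12n+2} - 448 q^{12n+4} + 84 q^{12n+6} + 187 q^{14n+3} - 560 q^{14n+5} + 36 q^{14n+7} - 9 q^{16n+2} + 509 q^{16n+4} - 441 q^{16n+6} + 9 q^{16n+8} - 65 q^{18n+3} + 805 q^{18n+5} - 225 q^{18n+7} + q^{18n+9} + q^{20n+2} - 225 q^{20n+4} + 805 q^{20n+6} - 65 q^{20n+8} + 9 q^{22n+3} - 441 q^{22n+5} + 509 q^{22n+7} - 9 q^{22n+9} + 36 q^{24n+4} - 560 q^{24n+6} + 187 q^{24n+8}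 + 84 q^{26n+5} - 448 q^{26n+7} + 35 q^{26n+9} + 126 q^{28n+6} - 231 q^{28n+8} + 126 q^{30n+7} - 63 q^{30n+9} + 84 q^{32n+8} - 7 q^{32n+10} + 36 q^{34n+9} + q^{34n+11} + 9 q^{36n+10} + q^{38n+11} + 1\] \[P_2(n)=q^{2n} + q^{4n} + 5 q^{2n+1} - 5 q^{4n+1} + 10 q^{4n+2} - 5 q^{6n+1} - 16 q^{6n+2} + 10 q^{6n+3} - q^{8n+1} - 11 q^{8n+2} - 25 q^{8n+3} + 5 q^{8n+4} + 19 q^{10n+2} - 14 q^{10n+3} - 15 q^{10n+4} + q^{10n+5} + q^{12n+2} + 46 q^{12n+3} - 4 q^{12n+4} - 4 q^{12n+5} - 4 q^{14n+2} - 4 q^{14n+3} + 46 q^{14n+4} + q^{14n+5} + q^{16n+2} - 15 q^{16n+3} - 14 q^{16n+4} + 19 q^{16n+5} + 5 q^{18n+3} - 25 q^{18n+4} - 11 q^{18n+5} - q^{18n+6} + 10 q^{20n+4} - 16 q^{20n+5} - 5 q^{20n+6} + 10 q^{22n+5} - 5 q^{22n+6} + q^{22n+7} + 5 q^{24n+6}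 + q^{24n+7} + q^{26n+7} + 1\] Then both of the following series converge (absolutely), with the stated sums: \[\sum_{n\geq 0} A_n(q)= \frac{(1-q^2)^4}{\Gamma_{q^2}(1/2)^8},\qquad A_n(q)=\frac{q^{4 n^2}P_1(n)\, (q^2;q^2)_{4 n}\, (q;q^2)_n^{16}}{(q^{4 n}+1) (q^{2 n+1}+1)^9 (q^2;q^2)_{2 n}^{10}},\] \[\sum_{n\geq 0} B_n(q)= \frac{(1-q^2)^4}{\Gamma_{q^2}(1/2)^8},\qquad B_n(q)=\frac{(-1)^n q^{n^2} P_2(n)\, (q;q^2)_{2 n}\, (q^2;q^2)_{3 n}\, (q;q^2)_n^{10}}{(q^{2 n}-q^n+1) (q^{2 n}+q^n+1) (q^{2 n+1}+1)^5 (q^2;q^2)_n^5 (q^2;q^2)_{2 n}^5}.\] They are $q$-analogues of the series of Cullen and of Zhao, \[\sum_{n\geq 0} \Big(\frac{1}{2^{12}}\Big)^n \frac{(\frac12)_n^7 (\frac14)_n(\frac34)_n}{(1)_n^9}(43680 n^4+20632 n^3+4340 n^2+466 n+21)=\frac{2048}{\pi ^4},\] \[\sum_{n\geq 0} \Big(-\frac{3^3}{2^8}\Big)^n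 \frac{(\frac12)_n^5 (\frac14)_n(\frac34)_n(\frac13)_n(\frac23)_n}{(1)_n^9}(4528 n^4+3180 n^3+972 n^2+147 n+9)=\frac{768}{\pi ^4},\] in the following sense (these two classical evaluations are known and are recalled, not asserted). If $a_n$ and $b_n$ denote the $n$-th summands of these two series, then for every $n\ge 0$, as $q\to 1^-$, \[\frac{A_n(q)}{(1-q^2)^4}\to\frac{a_n}{2048},\qquad \frac{B_n(q)}{(1-q^2)^4}\to\frac{b_n}{768},\] while the common right-hand side divided by $(1-q^2)^4$ tends to $\dfrac1{\pi^4}$. -/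

import Mathlib

open Filter Topology

/-- The finite `q`-shifted factorial `(a; q)_n = (1 - a)(1 - a q) ⋯ (1 - a q^(n-1))`. -/
noncomputable def qPoch (a q : ℝ) (n : ℕ) : ℝ :=
  ∏ k ∈ Finset.range n, (1 - a * q ^ k)

/-- The infinite `q`-shifted factorial `(a; q)_∞ = ∏_{k ≥ 0} (1 - a q^k)`. -/
noncomputable def qPochInf (a q : ℝ) : ℝ :=
  ∏' k : ℕ, (1 - a * q ^ k)

/-- The product defining `(a; q)_∞` converges for `|q| < 1`. -/
theorem multipliable_qPochInf (a : ℝ) {q : ℝ} (hq : |q| < 1) :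
    Multipliable fun k : ℕ => 1 - a * q ^ k := by
  have h : Summable fun k : ℕ => -(a * q ^ k) :=
    ((summable_geometric_of_abs_lt_one hq).mul_left a).neg
  simpa [sub_eq_add_neg] using Real.multipliable_one_add_of_summable h

/-- The `q`-gamma function `Γ_q(x) = (1 - q)^(1 - x) (q; q)_∞ / (q^x; q)_∞`, for `0 < q < 1`
and real `x`. -/
noncomputable def qGamma (q x : ℝ) : ℝ :=
  (1 - q) ^ (1 - x) * qPochInf q q / qPochInf (q ^ x) q

/-- The rising factorial `(a)_n = a (a + 1) ⋯ (a + n - 1)`. -/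
noncomputable def risingFac (a : ℝ) (n : ℕ) : ℝ :=
  (ascPochhammer ℝ n).eval a

/-- The polynomial factor `P₁(n)` of the `q`-analogue of Cullen's series. -/
noncomputable def cullenPoly (q : ℝ) (n : ℕ) : ℝ :=
  q ^ (4 * n) + 9 * q ^ (2 * n + 1) + 36 * q ^ (4 * n + 2) - 7 * q ^ (6 * n + 1) +
    84 * q ^ (6 * n + 3) - 63 * q ^ (8 * n + 2) + 126 * q ^ (8 * n + 4) -
    231 * q ^ (10 * n + 3) + 126 * q ^ (10 * n + 5) + 35 * q ^ (12 * n + 2) -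
    448 * q ^ (12 * n + 4) + 84 * q ^ (12 * n + 6) + 187 * q ^ (14 * n + 3) -
    560 * q ^ (14 * n + 5) + 36 * q ^ (14 * n + 7) - 9 * q ^ (16 * n + 2) +
    509 * q ^ (16 * n + 4) - 441 * q ^ (16 * n + 6) + 9 * q ^ (16 * n + 8) -
    65 * q ^ (18 * n + 3) + 805 * q ^ (18 * n + 5) - 225 * q ^ (18 * n + 7) +
    q ^ (18 * n + 9) + q ^ (20 * n + 2) - 225 * q ^ (20 * n + 4) + 805 * q ^ (20 * n + 6) -
    65 * q ^ (20 * n + 8) + 9 * q ^ (22 * n + 3) - 441 * q ^ (22 * n + 5) +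
    509 * q ^ (22 * n + 7) - 9 * q ^ (22 * n + 9) + 36 * q ^ (24 * n + 4) -
    560 * q ^ (24 * n + 6) + 187 * q ^ (24 * n + 8) + 84 * q ^ (26 * n + 5) -
    448 * q ^ (26 * n + 7) + 35 * q ^ (26 * n + 9) + 126 * q ^ (28 * n + 6) -
    231 * q ^ (28 * n + 8) + 126 * q ^ (30 * n + 7) - 63 * q ^ (30 * n + 9) +
    84 * q ^ (32 * n + 8) - 7 * q ^ (32 * n + 10) + 36 * q ^ (34 * n + 9) +
    q ^ (34 * n + 11) + 9 * q ^ (36 * n + 10) + q ^ (38 * n + 11) + 1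

/-- The polynomial factor `P₂(n)` of the `q`-analogue of Zhao's series. -/
noncomputable def zhaoPoly (q : ℝ) (n : ℕ) : ℝ :=
  q ^ (2 * n) + q ^ (4 * n) + 5 * q ^ (2 * n + 1) - 5 * q ^ (4 * n + 1) +
    10 * q ^ (4 * n + 2) - 5 * q ^ (6 * n + 1) - 16 * q ^ (6 * n + 2) +
    10 * q ^ (6 * n + 3) - q ^ (8 * n + 1) - 11 * q ^ (8 * n + 2) - 25 * q ^ (8 * n + 3) +
    5 * q ^ (8 * n + 4) + 19 * q ^ (10 * n + 2) - 14 * q ^ (10 * n + 3) -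
    15 * q ^ (10 * n + 4) + q ^ (10 * n + 5) + q ^ (12 * n + 2) + 46 * q ^ (12 * n + 3) -
    4 * q ^ (12 * n + 4) - 4 * q ^ (12 * n + 5) - 4 * q ^ (14 * n + 2) -
    4 * q ^ (14 * n + 3) + 46 * q ^ (14 * n + 4) + q ^ (14 * n + 5) + q ^ (16 * n + 2) -
    15 * q ^ (16 * n + 3) - 14 * q ^ (16 * n + 4) + 19 * q ^ (16 * n + 5) +
    5 * q ^ (18 * n + 3) - 25 * q ^ (18 * n + 4) - 11 * q ^ (18 * n + 5) -
    q ^ (18 * n + 6) + 10 * q ^ (20 * n + 4) - 16 * q ^ (20 * n + 5) -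
    5 * q ^ (20 * n + 6) + 10 * q ^ (22 * n + 5) - 5 * q ^ (22 * n + 6) + q ^ (22 * n + 7) +
    5 * q ^ (24 * n + 6) + q ^ (24 * n + 7) + q ^ (26 * n + 7) + 1

/-- The `n`-th term of the `q`-analogue of Cullen's series. -/
noncomputable def cullenQTerm (q : ℝ) (n : ℕ) : ℝ :=
  q ^ (4 * n ^ 2) * cullenPoly q n * qPoch (q ^ 2) (q ^ 2) (4 * n) * qPoch q (q ^ 2) n ^ 16 /
    ((q ^ (4 * n) + 1) * (q ^ (2 * n + 1) + 1) ^ 9 * qPoch (q ^ 2) (q ^ 2) (2 * n) ^ 10)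

/-- The `n`-th term of the `q`-analogue of Zhao's series. -/
noncomputable def zhaoQTerm (q : ℝ) (n : ℕ) : ℝ :=
  (-1) ^ n * q ^ (n ^ 2) * zhaoPoly q n * qPoch q (q ^ 2) (2 * n) *
      qPoch (q ^ 2) (q ^ 2) (3 * n) * qPoch q (q ^ 2) n ^ 10 /
    ((q ^ (2 * n) - q ^ n + 1) * (q ^ (2 * n) + q ^ n + 1) * (q ^ (2 * n + 1) + 1) ^ 5 *
      qPoch (q ^ 2) (q ^ 2) n ^ 5 * qPoch (q ^ 2) (q ^ 2) (2 * n) ^ 5)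

/-- The `n`-th term of Cullen's series, whose sum is `2048 / π ^ 4`. -/
noncomputable def cullenTerm (n : ℕ) : ℝ :=
  (1 / 2 ^ 12) ^ n *
    (risingFac (1 / 2) n ^ 7 * risingFac (1 / 4) n * risingFac (3 / 4) n / risingFac 1 n ^ 9) *
    (43680 * n ^ 4 + 20632 * n ^ 3 + 4340 * n ^ 2 + 466 * n + 21)

/-- The `n`-th term of Zhao's series, whose sum is `768 / π ^ 4`. -/
noncomputable def zhaoTerm (n : ℕ) : ℝ :=
  (-(3 ^ 3 / 2 ^ 8)) ^ n *
    (risingFac (1 / 2) n ^ 5 * risingFac (1 / 4) n * risingFac (3 / 4) n *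
      risingFac (1 / 3) n * risingFac (2 / 3) n / risingFac 1 n ^ 9) *
    (4528 * n ^ 4 + 3180 * n ^ 3 + 972 * n ^ 2 + 147 * n + 9)

/-! Both evaluations are WZ arguments. Attach H(a,b) to the lattice edge from (a,b) to (a+1,b) and
V(a,b) to the edge from (a,b) to (a,b+1). If the sum around each unit square below the diagonal
vanishes, the sum along a path depends only on its endpoints. The staircase from (0,0) to (N,N) then
has the same sum as the path along the bottom and up the line a = N (`sum_staircase_eq`). The bottom
contributes nothing since H(a,0) = 0. On the line a = N every term except V(N,0) is O(q^N), so the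
sum tends to lim V(N,0) (`tendsto_row_sum`). This limit is ((q;q²)_∞/(q²;q²)_∞)^8 in both cases,
which is the q-gamma side by `one_sub_pow_div_qGamma_half`.

It remains to exhibit the forms. Each is a q-hypergeometric kernel times a rational function of A =
q^(2a) and B or C = q^(2b) or q^(2c). Closedness reduces to a polynomial identity
(`cullenRat_closed`, `zhaoKappa_closed`), and the two edges of one stair add up to the given summand
(`cullenQTerm_eq`, `zhaoQTerm_eq`).

As q → 1, each (1 - q^j)/(1 - q²) tends to j/2. The q-factorials in a summand contribute equal
powers of 1 - q² above and below, and the polynomial factor, written as in `cullenPoly_eq` or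
`zhaoPoly_eq`, supplies the fourth power. On the q-gamma side, finite products bound the infinite
ratio on both sides, and Wallis' product gives 1/π. -/

/-! ### Finite and infinite q-shifted factorials -/

theorem qPoch_zero (a q : ℝ) : qPoch a q 0 = 1 := by simp [qPoch]

theorem qPoch_succ (a q : ℝ) (n : ℕ) : qPoch a q (n + 1) = qPoch a q n * (1 - a * q ^ n) := by
  simp [qPoch, Finset.prod_range_succ]

theorem qPoch_factor_pos {a q : ℝ} (ha0 : 0 < a) (ha : a < 1) (hq0 : 0 < q) (hq : q < 1) (k : ℕ) :
    0 < 1 - a * q ^ k ∧ 1 - a * q ^ k < 1 := by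
  have h1 : q ^ k ≤ 1 := pow_le_one₀ hq0.le hq.le
  have h2 : 0 < q ^ k := by positivity
  constructor
  · nlinarith
  · nlinarith [mul_pos ha0 h2]

theorem qPoch_pos {a q : ℝ} (ha0 : 0 < a) (ha : a < 1) (hq0 : 0 < q) (hq : q < 1) (n : ℕ) :
    0 < qPoch a q n :=
  Finset.prod_pos fun k _ => (qPoch_factor_pos ha0 ha hq0 hq k).1

theorem qPoch_antitone {a q : ℝ} (ha0 : 0 < a) (ha : a < 1) (hq0 : 0 < q) (hq : q < 1) :
    Antitone (qPoch a q) := by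
  refine antitone_nat_of_succ_le fun n => ?_
  rw [qPoch_succ]
  exact mul_le_of_le_one_right (qPoch_pos ha0 ha hq0 hq n).le
    (qPoch_factor_pos ha0 ha hq0 hq n).2.le

theorem qPoch_le_one {a q : ℝ} (ha0 : 0 < a) (ha : a < 1) (hq0 : 0 < q) (hq : q < 1) (n : ℕ) :
    qPoch a q n ≤ 1 := by
  simpa [qPoch_zero] using qPoch_antitone ha0 ha hq0 hq (Nat.zero_le n)

theorem tendsto_qPoch (a : ℝ) {q : ℝ} (hq0 : 0 < q) (hq : q < 1) :
    Tendsto (qPoch a q) atTop (𝓝 (qPochInf a q)) :=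
  (multipliable_qPochInf a (by rwa [abs_of_pos hq0])).hasProd.tendsto_prod_nat

/-- A decreasing limit of positive products could be zero; summability of the logarithms excludes
this by writing the limit as an exponential. -/
theorem qPochInf_pos {a q : ℝ} (ha0 : 0 < a) (ha : a < 1) (hq0 : 0 < q) (hq : q < 1) :
    0 < qPochInf a q := by
  have hs : Summable fun k : ℕ => -(a * q ^ k) :=
    ((summable_geometric_of_lt_one hq0.le hq).mul_left a).neg
  have hlog := Real.summable_log_one_add_of_summable hs
  have h := Real.rexp_tsum_eq_tprod (f := fun k : ℕ => 1 - a * q ^ k)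
    (fun k => (qPoch_factor_pos ha0 ha hq0 hq k).1) (by simpa [sub_eq_add_neg] using hlog)
  rw [qPochInf, ← h]
  exact Real.exp_pos _

theorem qPochInf_le_qPoch {a q : ℝ} (ha0 : 0 < a) (ha : a < 1) (hq0 : 0 < q) (hq : q < 1) (n : ℕ) :
    qPochInf a q ≤ qPoch a q n :=
  (qPoch_antitone ha0 ha hq0 hq).le_of_tendsto (tendsto_qPoch a hq0 hq) n

/-- The eighth power of the reciprocal `q`-gamma value, as an infinite product. -/
theorem one_sub_pow_div_qGamma_half {q : ℝ} (hq0 : 0 < q) (hq : q < 1) :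
    (1 - q ^ 2) ^ 4 / qGamma (q ^ 2) (1 / 2) ^ 8 =
      (qPochInf q (q ^ 2) / qPochInf (q ^ 2) (q ^ 2)) ^ 8 := by
  have hQ0 : 0 < q ^ 2 := by positivity
  have hQ : q ^ 2 < 1 := pow_lt_one₀ hq0.le hq two_ne_zero
  have h1 := qPochInf_pos hQ0 hQ hQ0 hQ
  have h2 := qPochInf_pos hq0 hq hQ0 hQ
  have h3 : (q ^ 2) ^ (1 / 2 : ℝ) = q := by
    rw [← Real.sqrt_eq_rpow, Real.sqrt_sq hq0.le]
  have h4 : ((1 - q ^ 2) ^ (1 - 1 / 2 : ℝ)) ^ 8 = (1 - q ^ 2) ^ 4 := by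
    rw [← Real.rpow_natCast, ← Real.rpow_mul (by linarith)]
    norm_num
  have h5 : 0 < 1 - q ^ 2 := by linarith
  rw [qGamma, h3, div_pow, mul_pow, h4]
  field_simp

/-! ### Path independence and the limit of the far column -/

/-- Telescoping a closed discrete `1`-form: the sum along the diagonal staircase equals the sum
along a vertical line. -/
theorem sum_staircase_eq {H V : ℕ → ℕ → ℝ} (h0 : ∀ a, H a 0 = 0)
    (hc : ∀ a b, b < a → H a (b + 1) - H a b = V (a + 1) b - V a b) (N : ℕ) :
    ∑ n ∈ Finset.range N, (H n n + V (n + 1) n) = ∑ b ∈ Finset.range N, V N b := by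
  induction N with
  | zero => simp
  | succ N ih =>
    -- Closedness on the squares between the lines a = N and a = N + 1 below the diagonal: the left
    -- side telescopes to H N N, the change between the two column sums apart from the new top edge.
    have h1 : ∑ b ∈ Finset.range N, (H N (b + 1) - H N b) =
        ∑ b ∈ Finset.range N, (V (N + 1) b - V N b) :=
      Finset.sum_congr rfl fun b hb => hc N b (Finset.mem_range.1 hb)
    rw [Finset.sum_range_sub, h0, Finset.sum_sub_distrib] at h1
    rw [Finset.sum_range_succ, Finset.sum_range_succ, ih]
    linarith

/-- If all terms but the first of the `N`-th row are uniformly `O(r ^ N)`, the row sums converge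
to the limit of the first terms. -/
theorem tendsto_row_sum {V : ℕ → ℕ → ℝ} {K r L : ℝ} (hK : 0 ≤ K) (hr0 : 0 ≤ r) (hr : r < 1)
    (hV : ∀ N b, 0 < b → b < N → |V N b| ≤ K * r ^ N)
    (hL : Tendsto (fun N => V N 0) atTop (𝓝 L)) :
    Tendsto (fun N => ∑ b ∈ Finset.range N, V N b) atTop (𝓝 L) := by
  have h1 : Tendsto (fun N : ℕ => K * (N * r ^ N)) atTop (𝓝 0) := by
    simpa using (tendsto_self_mul_const_pow_of_lt_one hr0 hr).const_mul K
  have h2 : Tendsto (fun N => (∑ b ∈ Finset.range N, V N b) - V N 0) atTop (𝓝 0) := by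
    refine squeeze_zero_norm' ?_ h1
    filter_upwards [eventually_ge_atTop 1] with N hN
    obtain ⟨M, rfl⟩ := Nat.exists_eq_succ_of_ne_zero (by omega : N ≠ 0)
    rw [Finset.sum_range_succ', add_sub_cancel_right]
    refine (norm_sum_le _ _).trans ?_
    refine (Finset.sum_le_card_nsmul _ _ (K * r ^ (M + 1)) fun b hb => ?_).trans ?_
    · exact hV _ _ (Nat.succ_pos b) (by have := Finset.mem_range.1 hb; omega)
    · have h3 : 0 ≤ K * r ^ (M + 1) := by positivity
      simp only [Finset.card_range, nsmul_eq_mul, Nat.succ_eq_add_one]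
      push_cast
      linarith
  simpa using h2.add hL

/-! ### The closed form behind Cullen's series -/

/-- The polynomial `Θ(U, W)` occurring in the WZ form behind Cullen's series. -/
noncomputable def cullenTheta (U W : ℝ) : ℝ :=
  U ^ 2 * W ^ 2 + U ^ 2 * W + U * W ^ 2 - 6 * U * W + U + W + 1

/-- The rational factor of `cullenForm`, with `A = q ^ (2 a)` and `B = q ^ (2 b)`. -/
noncomputable def cullenRat (q A B : ℝ) : ℝ :=
  (1 - B ^ 2) * (1 - q * A ^ 2 * B) * cullenTheta (A * B) (q * A) / ((1 + A * B) * (1 + q * A))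

/-- The symmetric product underlying `cullenForm`. -/
noncomputable def cullenKernel (q : ℝ) (a b : ℕ) : ℝ :=
  q ^ (4 * a * b) * qPoch (q ^ 2) (q ^ 2) (2 * a + 2 * b) * qPoch q (q ^ 2) a ^ 8 *
      qPoch q (q ^ 2) b ^ 8 /
    (qPoch (q ^ 2) (q ^ 2) (2 * a) * qPoch (q ^ 2) (q ^ 2) (2 * b) *
      qPoch (q ^ 2) (q ^ 2) (a + b) ^ 8)

/-- The horizontal component of the discrete closed `1`-form on `ℕ × ℕ` behind Cullen's series;
the vertical component is its mirror image. -/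
noncomputable def cullenForm (q : ℝ) (a b : ℕ) : ℝ :=
  cullenRat q (q ^ (2 * a)) (q ^ (2 * b)) * cullenKernel q a b

theorem cullenKernel_symm (q : ℝ) (a b : ℕ) : cullenKernel q a b = cullenKernel q b a := by
  unfold cullenKernel
  rw [show 4 * a * b = 4 * b * a by ring, add_comm (2 * a), add_comm a]
  ring

theorem one_sub_pow_pos {q : ℝ} (hq0 : 0 < q) (hq : q < 1) {n : ℕ} (hn : n ≠ 0) :
    0 < 1 - q ^ n :=
  sub_pos.2 (pow_lt_one₀ hq0.le hq hn)

/-- The kernel is q-hypergeometric, so its step ratio is rational in q^(2a) and q^(2b). Factors are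
only regrouped, never cancelled, so no nonvanishing is needed. -/
theorem cullenKernel_succ (q : ℝ) (a b : ℕ) :
    cullenKernel q a (b + 1) = cullenKernel q a b *
      ((q ^ (2 * a)) ^ 2 * (1 - q ^ 2 * (q ^ (2 * a)) ^ 2 * (q ^ (2 * b)) ^ 2) *
        (1 - q ^ 4 * (q ^ (2 * a)) ^ 2 * (q ^ (2 * b)) ^ 2) * (1 - q * q ^ (2 * b)) ^ 8 /
        ((1 - q ^ 2 * (q ^ (2 * b)) ^ 2) * (1 - q ^ 4 * (q ^ (2 * b)) ^ 2) *
          (1 - q ^ 2 * q ^ (2 * a) * q ^ (2 * b)) ^ 8)) := by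
  have p1 : qPoch (q ^ 2) (q ^ 2) (2 * a + 2 * (b + 1)) = qPoch (q ^ 2) (q ^ 2) (2 * a + 2 * b) *
      (1 - q ^ 2 * (q ^ (2 * a)) ^ 2 * (q ^ (2 * b)) ^ 2) *
      (1 - q ^ 4 * (q ^ (2 * a)) ^ 2 * (q ^ (2 * b)) ^ 2) := by
    rw [show 2 * a + 2 * (b + 1) = 2 * a + 2 * b + 1 + 1 by ring, qPoch_succ, qPoch_succ]
    ring
  have p2 : qPoch (q ^ 2) (q ^ 2) (2 * (b + 1)) = qPoch (q ^ 2) (q ^ 2) (2 * b) *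
      (1 - q ^ 2 * (q ^ (2 * b)) ^ 2) * (1 - q ^ 4 * (q ^ (2 * b)) ^ 2) := by
    rw [show 2 * (b + 1) = 2 * b + 1 + 1 by ring, qPoch_succ, qPoch_succ]
    ring
  have p3 : qPoch (q ^ 2) (q ^ 2) (a + (b + 1)) = qPoch (q ^ 2) (q ^ 2) (a + b) *
      (1 - q ^ 2 * q ^ (2 * a) * q ^ (2 * b)) := by
    rw [← add_assoc, qPoch_succ]
    ring
  have p4 : qPoch q (q ^ 2) (b + 1) = qPoch q (q ^ 2) b * (1 - q * q ^ (2 * b)) := by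
    rw [qPoch_succ, ← pow_mul]
  have p5 : q ^ (4 * a * (b + 1)) = q ^ (4 * a * b) * (q ^ (2 * a)) ^ 2 := by ring
  unfold cullenKernel
  rw [p1, p2, p3, p4, p5]
  rw [div_mul_div_comm]
  congr 1 <;> ring

/-- The rational-function identity expressing that `cullenForm` is closed. -/
theorem cullenRat_closed {q A B : ℝ} (h1 : 1 + A * B ≠ 0) (h2 : 1 + q * A ≠ 0)
    (h3 : 1 + q * B ≠ 0) (h4 : 1 - q * A ≠ 0) (h5 : 1 - q * B ≠ 0)
    (h6 : 1 - q ^ 2 * A * B ≠ 0) (h7 : 1 + q ^ 2 * A * B ≠ 0)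
    (h8 : 1 - q ^ 4 * A ^ 2 ≠ 0) (h9 : 1 - q ^ 4 * B ^ 2 ≠ 0) :
    cullenRat q A (q ^ 2 * B) *
        (A ^ 2 * (1 - q ^ 2 * A ^ 2 * B ^ 2) * (1 - q ^ 4 * A ^ 2 * B ^ 2) * (1 - q * B) ^ 8 /
          ((1 - q ^ 2 * B ^ 2) * (1 - q ^ 4 * B ^ 2) * (1 - q ^ 2 * A * B) ^ 8)) -
        cullenRat q A B =
      cullenRat q B (q ^ 2 * A) *
        (B ^ 2 * (1 - q ^ 2 * B ^ 2 * A ^ 2) * (1 - q ^ 4 * B ^ 2 * A ^ 2) * (1 - q * A) ^ 8 /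
          ((1 - q ^ 2 * A ^ 2) * (1 - q ^ 4 * A ^ 2) * (1 - q ^ 2 * B * A) ^ 8)) -
        cullenRat q B A := by
  have key : ∀ A B : ℝ, 1 + q * A ≠ 0 → 1 + q * B ≠ 0 → 1 - q * B ≠ 0 →
      1 - q ^ 2 * A * B ≠ 0 → 1 + q ^ 2 * A * B ≠ 0 → 1 - q ^ 4 * B ^ 2 ≠ 0 →
      cullenRat q A (q ^ 2 * B) *
        (A ^ 2 * (1 - q ^ 2 * A ^ 2 * B ^ 2) * (1 - q ^ 4 * A ^ 2 * B ^ 2) * (1 - q * B) ^ 8 /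
          ((1 - q ^ 2 * B ^ 2) * (1 - q ^ 4 * B ^ 2) * (1 - q ^ 2 * A * B) ^ 8)) =
      (1 - q ^ 2 * A ^ 2 * B ^ 2) * (A ^ 2 * (1 - q * B) ^ 7 * (1 - q ^ 3 * A ^ 2 * B) *
        cullenTheta (q ^ 2 * A * B) (q * A)) /
        ((1 - q ^ 2 * A * B) ^ 7 * (1 + q * A) * (1 + q * B)) := by
    intro A B h2 h3 h5 h6 h7 h9
    rw [cullenRat, show 1 - q ^ 2 * B ^ 2 = (1 - q * B) * (1 + q * B) by ring,
      show 1 - q ^ 4 * A ^ 2 * B ^ 2 = (1 - q ^ 2 * A * B) * (1 + q ^ 2 * A * B) by ring,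
      show 1 - (q ^ 2 * B) ^ 2 = 1 - q ^ 4 * B ^ 2 by ring,
      show A * (q ^ 2 * B) = q ^ 2 * A * B by ring,
      show 1 - q * A ^ 2 * (q ^ 2 * B) = 1 - q ^ 3 * A ^ 2 * B by ring]
    -- With the factors as opaque atoms, the cancellation becomes one of monomials and nothing is
    -- expanded.
    generalize 1 - q ^ 4 * B ^ 2 = y1 at *
    generalize 1 - q ^ 2 * A * B = y2 at *
    generalize 1 + q ^ 2 * A * B = y3 at *
    generalize 1 - q * B = y4 at *
    generalize 1 + q * B = y5 at *
    generalize cullenTheta (q ^ 2 * A * B) (q * A) = y6 at *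
    generalize 1 + q * A = y7 at *
    field_simp
  rw [key A B h2 h3 h5 h6 h7 h9, key B A h3 h2 h4 (by rwa [mul_right_comm])
    (by rwa [mul_right_comm]) h8]
  -- Closedness with all denominators cleared.
  have main : (1 + A * B) * (1 - q ^ 2 * A ^ 2 * B ^ 2) *
      (A ^ 2 * (1 - q * B) ^ 7 * (1 - q ^ 3 * A ^ 2 * B) * cullenTheta (q ^ 2 * A * B) (q * A) -
        B ^ 2 * (1 - q * A) ^ 7 * (1 - q ^ 3 * B ^ 2 * A) * cullenTheta (q ^ 2 * B * A) (q * B)) =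
      (1 - q ^ 2 * A * B) ^ 7 *
        ((1 - B ^ 2) * (1 - q * A ^ 2 * B) * cullenTheta (A * B) (q * A) * (1 + q * B) -
          (1 - A ^ 2) * (1 - q * B ^ 2 * A) * cullenTheta (B * A) (q * B) * (1 + q * A)) := by
    unfold cullenTheta
    ring
  have key2 : ∀ P1 P2 N1 N2 d e f g : ℝ, d ≠ 0 → e ≠ 0 → f ≠ 0 → g ≠ 0 →
      g * (P1 - P2) = d ^ 7 * (N1 * f - N2 * e) →
      P1 / (d ^ 7 * e * f) - N1 / (g * e) = P2 / (d ^ 7 * f * e) - N2 / (g * f) := by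
    intro P1 P2 N1 N2 d e f g hd he hf hg h
    field_simp
    linear_combination h
  rw [mul_right_comm (q ^ 2) B A] at main ⊢
  unfold cullenRat
  rw [mul_comm B A] at main ⊢
  exact key2 _ _ _ _ _ _ _ _ h6 h2 h3 h1 (by linear_combination main)

/-- By symmetry of the kernel, both step ratios are the same function with A and B exchanged; the
common factor `cullenKernel q a b` then leaves `cullenRat_closed`. -/
theorem cullenForm_closed {q : ℝ} (hq0 : 0 < q) (hq : q < 1) (a b : ℕ) :
    cullenForm q a (b + 1) - cullenForm q a b = cullenForm q b (a + 1) - cullenForm q b a := by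
  have e : ∀ c : ℕ, q ^ (2 * (c + 1)) = q ^ 2 * q ^ (2 * c) := fun c => by ring
  unfold cullenForm
  rw [cullenKernel_succ q, cullenKernel_succ q, cullenKernel_symm q b a, e, e]
  have h4 : ∀ c : ℕ, 1 - q * q ^ (2 * c) ≠ 0 := fun c => by
    rw [← pow_succ']; exact (one_sub_pow_pos hq0 hq (by omega)).ne'
  have h8 : ∀ c : ℕ, 1 - q ^ 4 * (q ^ (2 * c)) ^ 2 ≠ 0 := fun c => by
    rw [← pow_mul, ← pow_add]; exact (one_sub_pow_pos hq0 hq (by omega)).ne'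
  have h6 : 1 - q ^ 2 * q ^ (2 * a) * q ^ (2 * b) ≠ 0 := by
    rw [← pow_add, ← pow_add]; exact (one_sub_pow_pos hq0 hq (by omega)).ne'
  have := cullenRat_closed (q := q) (A := q ^ (2 * a)) (B := q ^ (2 * b))
    (by positivity) (by positivity) (by positivity) (h4 a) (h4 b) h6 (by positivity) (h8 a) (h8 b)
  linear_combination cullenKernel q a b * this

theorem cullenForm_zero_right (q : ℝ) (a : ℕ) : cullenForm q a 0 = 0 := by
  simp [cullenForm, cullenRat]

/-- The two summands are the numerators of the horizontal and the vertical edge of a stair over a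
common denominator. Each vanishes to order four at q = 1: two simple factors and a double zero of
`cullenTheta`. -/
theorem cullenPoly_eq (q : ℝ) (n : ℕ) :
    cullenPoly q n =
      (1 - (q ^ (2 * n)) ^ 2) * (1 - q * (q ^ (2 * n)) ^ 3) *
        cullenTheta ((q ^ (2 * n)) ^ 2) (q * q ^ (2 * n)) * (1 + q * q ^ (2 * n)) ^ 8 +
      (q ^ (2 * n)) ^ 2 * (1 + (q ^ (2 * n)) ^ 2) * (1 - q ^ 2 * (q ^ (2 * n)) ^ 4) *
        (1 - q ^ 3 * (q ^ (2 * n)) ^ 3) *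
        cullenTheta (q ^ 2 * (q ^ (2 * n)) ^ 2) (q * q ^ (2 * n)) := by
  unfold cullenPoly cullenTheta
  ring

/-- The vertical edge from (n+1,n) is `cullenForm q n (n + 1)` by mirror symmetry. Its kernel is
that at (n,n) times a ratio in which (1 - qX)^8 cancels, X = q^(2n); this leaves (1 + qX)^8, and
`cullenRat` supplies the ninth power. -/
theorem cullenQTerm_eq {q : ℝ} (hq0 : 0 < q) (hq : q < 1) (n : ℕ) :
    cullenQTerm q n = cullenForm q n n + cullenForm q n (n + 1) := by
  have hQ0 : 0 < q ^ 2 := by positivity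
  have hQ : q ^ 2 < 1 := pow_lt_one₀ hq0.le hq two_ne_zero
  have hX : 0 < q ^ (2 * n) := by positivity
  have h2 := (qPoch_pos hQ0 hQ hQ0 hQ (2 * n)).ne'
  have e1 : 1 - q * q ^ (2 * n) ≠ 0 := by
    rw [← pow_succ']; exact (one_sub_pow_pos hq0 hq (by omega)).ne'
  have e2 : 1 - q ^ 4 * (q ^ (2 * n)) ^ 2 ≠ 0 := by
    rw [← pow_mul, ← pow_add]; exact (one_sub_pow_pos hq0 hq (by omega)).ne'
  have e3 : 1 + q * q ^ (2 * n) ≠ 0 := by positivity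
  have e4 : 1 + (q ^ (2 * n)) ^ 2 ≠ 0 := by positivity
  have e5 : 1 + q ^ 2 * (q ^ (2 * n)) ^ 2 ≠ 0 := by positivity
  have e : q ^ (2 * (n + 1)) = q ^ 2 * q ^ (2 * n) := by ring
  have k0 : cullenKernel q n n = q ^ (4 * n ^ 2) * qPoch (q ^ 2) (q ^ 2) (4 * n) *
      qPoch q (q ^ 2) n ^ 16 / qPoch (q ^ 2) (q ^ 2) (2 * n) ^ 10 := by
    unfold cullenKernel
    rw [show 2 * n + 2 * n = 4 * n by ring, show n + n = 2 * n by ring,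
      show 4 * n * n = 4 * n ^ 2 by ring]
    ring
  unfold cullenForm
  rw [cullenKernel_succ q, k0, cullenQTerm, cullenPoly_eq, e, cullenRat, cullenRat,
    show q ^ (4 * n) = (q ^ (2 * n)) ^ 2 by ring, show q ^ (2 * n + 1) = q * q ^ (2 * n) by ring]
  generalize q ^ (2 * n) = X at *
  rw [show 1 - q ^ 2 * X ^ 2 * X ^ 2 = 1 - q ^ 2 * X ^ 4 by ring,
    show 1 - q ^ 4 * X ^ 2 * X ^ 2 = (1 - q * X) * (1 + q * X) * (1 + q ^ 2 * X ^ 2) by ring,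
    show 1 - q ^ 2 * X ^ 2 = (1 - q * X) * (1 + q * X) by ring,
    show 1 - q ^ 2 * X * X = (1 - q * X) * (1 + q * X) by ring,
    show 1 - (q ^ 2 * X) ^ 2 = 1 - q ^ 4 * X ^ 2 by ring,
    show X * (q ^ 2 * X) = q ^ 2 * X ^ 2 by ring,
    show X * X = X ^ 2 by ring,
    show 1 - q * X ^ 2 * X = 1 - q * X ^ 3 by ring,
    show 1 - q * X ^ 2 * (q ^ 2 * X) = 1 - q ^ 3 * X ^ 3 by ring,
    add_comm (X ^ 2) 1, add_comm (q * X) 1]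
  generalize 1 - q * X = y1 at *
  generalize 1 + q * X = y2 at *
  generalize 1 - q ^ 4 * X ^ 2 = y3 at *
  generalize 1 + q ^ 2 * X ^ 2 = y4 at *
  generalize 1 + X ^ 2 = y5 at *
  generalize 1 - X ^ 2 = y6 at *
  generalize 1 - q * X ^ 3 = y7 at *
  generalize 1 - q ^ 3 * X ^ 3 = y8 at *
  generalize 1 - q ^ 2 * X ^ 4 = y9 at *
  generalize cullenTheta (X ^ 2) (q * X) = t1 at *
  generalize cullenTheta (q ^ 2 * X ^ 2) (q * X) = t2 at *
  field_simp

theorem abs_cullenRat_le {q A B : ℝ} (hq0 : 0 < q) (hq : q < 1) (hA0 : 0 ≤ A) (hA : A ≤ 1)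
    (hB0 : 0 ≤ B) (hB : B ≤ 1) : |cullenRat q A B| ≤ 12 := by
  have hAB0 : 0 ≤ A * B := by positivity
  have hAB : A * B ≤ 1 := mul_le_one₀ hA hB0 hB
  have hqA0 : 0 ≤ q * A := by positivity
  have hqA : q * A ≤ 1 := mul_le_one₀ hq.le hA0 hA
  have t1 : |1 - B ^ 2| ≤ 1 := by rw [abs_le]; constructor <;> nlinarith
  have t2 : |1 - q * A ^ 2 * B| ≤ 1 := by
    have h0 : 0 ≤ q * A * (A * B) := by positivity
    have h1 : q * A * (A * B) ≤ 1 := mul_le_one₀ hqA hAB0 hAB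
    rw [show q * A ^ 2 * B = q * A * (A * B) by ring, abs_le]; constructor <;> linarith
  have t3 : |cullenTheta (A * B) (q * A)| ≤ 12 := by
    unfold cullenTheta
    generalize A * B = U at *
    generalize q * A = W at *
    have a1 : U * W ≤ 1 := mul_le_one₀ hAB hqA0 hqA
    have a2 : 0 ≤ U * W := by positivity
    have a3 : U * W * (U * W) ≤ 1 := mul_le_one₀ a1 a2 a1
    have a4 : U * W * U ≤ 1 := mul_le_one₀ a1 hAB0 hAB
    have a5 : U * W * W ≤ 1 := mul_le_one₀ a1 hqA0 hqA
    have a6 : 0 ≤ U * W * (U * W) := by positivity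
    have a7 : 0 ≤ U * W * U := by positivity
    have a8 : 0 ≤ U * W * W := by positivity
    rw [abs_le]; constructor <;> nlinarith
  unfold cullenRat
  rw [abs_div, abs_mul, abs_mul]
  have hd : 1 ≤ |(1 + A * B) * (1 + q * A)| := by
    rw [abs_of_nonneg (by positivity)]; nlinarith
  calc _ ≤ |1 - B ^ 2| * |1 - q * A ^ 2 * B| * |cullenTheta (A * B) (q * A)| / 1 := by gcongr
    _ ≤ 1 * 1 * 12 / 1 := by gcongr
    _ = 12 := by norm_num

theorem exists_abs_cullenForm_le {q : ℝ} (hq0 : 0 < q) (hq : q < 1) :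
    ∃ K : ℝ, 0 ≤ K ∧ ∀ a b : ℕ, |cullenForm q a b| ≤ K * q ^ (4 * a * b) := by
  have hQ0 : 0 < q ^ 2 := by positivity
  have hQ : q ^ 2 < 1 := pow_lt_one₀ hq0.le hq two_ne_zero
  have hL := qPochInf_pos hQ0 hQ hQ0 hQ
  have hle := qPochInf_le_qPoch hQ0 hQ hQ0 hQ
  set L := qPochInf (q ^ 2) (q ^ 2)
  -- 12 bounds the rational factor. The kernel's denominator has ten q-factorials, counted with
  -- multiplicity, each at least L; those in the numerator are at most 1.
  refine ⟨12 / L ^ 10, by positivity, fun a b => ?_⟩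
  have hp := qPoch_pos hQ0 hQ hQ0 hQ
  have hp' := qPoch_pos hq0 hq hQ0 hQ
  have h1 := qPoch_le_one hQ0 hQ hQ0 hQ
  have h1' := qPoch_le_one hq0 hq hQ0 hQ
  have hk : |cullenKernel q a b| ≤ q ^ (4 * a * b) / L ^ 10 := by
    have n1 := hp (2 * a + 2 * b)
    have n2 := hp' a
    have n3 := hp' b
    have n4 := hp (2 * a)
    have n5 := hp (2 * b)
    have n6 := hp (a + b)
    unfold cullenKernel
    rw [abs_of_nonneg (by positivity)]
    calc _ ≤ q ^ (4 * a * b) * 1 * 1 ^ 8 * 1 ^ 8 / (L * L * L ^ 8) := by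
          gcongr
          exacts [h1 _, h1' _, h1' _, hle _, hle _, hle _]
      _ = _ := by ring
  have hr := abs_cullenRat_le hq0 hq (A := q ^ (2 * a)) (B := q ^ (2 * b)) (by positivity)
    (pow_le_one₀ hq0.le hq.le) (by positivity) (pow_le_one₀ hq0.le hq.le)
  unfold cullenForm
  rw [abs_mul]
  calc _ ≤ 12 * (q ^ (4 * a * b) / L ^ 10) := by gcongr
    _ = _ := by ring

theorem tendsto_pow_two_mul {q : ℝ} (hq0 : 0 < q) (hq : q < 1) :
    Tendsto (fun n : ℕ => q ^ (2 * n)) atTop (𝓝 0) := by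
  simp_rw [pow_mul]
  exact tendsto_pow_atTop_nhds_zero_of_lt_one (by positivity) (pow_lt_one₀ hq0.le hq two_ne_zero)

/-- At a = 0 the factors (q²;q²)_{2N} cancel from the kernel, and the rational factor tends to
Θ(0,q)/(1+q) = 1. -/
theorem tendsto_cullenForm_zero_left {q : ℝ} (hq0 : 0 < q) (hq : q < 1) :
    Tendsto (fun N => cullenForm q 0 N) atTop
      (𝓝 ((qPochInf q (q ^ 2) / qPochInf (q ^ 2) (q ^ 2)) ^ 8)) := by
  have hQ0 : 0 < q ^ 2 := by positivity
  have hQ : q ^ 2 < 1 := pow_lt_one₀ hq0.le hq two_ne_zero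
  have hL := qPochInf_pos hQ0 hQ hQ0 hQ
  have hX := tendsto_pow_two_mul hq0 hq
  have hrat : Tendsto (fun N : ℕ => cullenRat q (q ^ (2 * 0)) (q ^ (2 * N))) atTop (𝓝 1) := by
    have hc : ContinuousAt (fun B : ℝ => cullenRat q (q ^ (2 * 0)) B) 0 := by
      unfold cullenRat cullenTheta
      have : (1 + q ^ (2 * 0) * (0 : ℝ)) * (1 + q * q ^ (2 * 0)) ≠ 0 := by positivity
      fun_prop (disch := exact this)
    have h0 : cullenRat q (q ^ (2 * 0)) 0 = 1 := by
      have : 1 + q ≠ 0 := by positivity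
      simp [cullenRat, cullenTheta]
      field_simp
      ring
    have h := hc.tendsto.comp hX
    rw [h0] at h
    exact h
  have hker : Tendsto (fun N : ℕ => cullenKernel q 0 N) atTop
      (𝓝 ((qPochInf q (q ^ 2) / qPochInf (q ^ 2) (q ^ 2)) ^ 8)) := by
    have : ∀ N, cullenKernel q 0 N = (qPoch q (q ^ 2) N / qPoch (q ^ 2) (q ^ 2) N) ^ 8 := by
      intro N
      have h1 := (qPoch_pos hQ0 hQ hQ0 hQ (2 * N)).ne'
      simp only [cullenKernel, qPoch_zero, mul_zero, zero_mul, pow_zero, zero_add]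
      field_simp
    simp_rw [this]
    exact ((tendsto_qPoch q hQ0 hQ).div (tendsto_qPoch (q ^ 2) hQ0 hQ) hL.ne').pow 8
  simpa [cullenForm] using hrat.mul hker

/-! ### Summation of the q-analogue of Cullen's series -/

/-- Telescoping controls only the ordered partial sums; geometric domination supplies the absolute
convergence behind `HasSum`. -/
theorem hasSum_of_abs_le_of_tendsto_sum_range {f : ℕ → ℝ} {K r L : ℝ} (hr0 : 0 ≤ r) (hr : r < 1)
    (hf : ∀ n, |f n| ≤ K * r ^ n)
    (hL : Tendsto (fun N => ∑ n ∈ Finset.range N, f n) atTop (𝓝 L)) : HasSum f L := by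
  have hs : Summable f :=
    Summable.of_norm_bounded ((summable_geometric_of_lt_one hr0 hr).mul_left K) hf
  rw [← tendsto_nhds_unique hs.hasSum.tendsto_sum_nat hL]
  exact hs.hasSum

theorem hasSum_cullenQTerm {q : ℝ} (hq0 : 0 < q) (hq : q < 1) :
    HasSum (cullenQTerm q) ((1 - q ^ 2) ^ 4 / qGamma (q ^ 2) (1 / 2) ^ 8) := by
  rw [one_sub_pow_div_qGamma_half hq0 hq]
  obtain ⟨K, hK, hb⟩ := exists_abs_cullenForm_le hq0 hq
  have hb' : ∀ a b m : ℕ, m ≤ 4 * a * b → |cullenForm q a b| ≤ K * q ^ m := fun a b m h =>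
    (hb a b).trans (mul_le_mul_of_nonneg_left (pow_le_pow_of_le_one hq0.le hq.le h) hK)
  refine hasSum_of_abs_le_of_tendsto_sum_range (K := 2 * K) hq0.le hq (fun n => ?_) ?_
  · rw [cullenQTerm_eq hq0 hq]
    refine (abs_add_le _ _).trans ?_
    linarith [hb' n n n (by nlinarith [Nat.le_mul_self n]), hb' n (n + 1) n (by nlinarith)]
  · have h := sum_staircase_eq (H := cullenForm q) (V := fun a b => cullenForm q b a)
      (cullenForm_zero_right q) (fun a b _ => cullenForm_closed hq0 hq a b)
    simp_rw [cullenQTerm_eq hq0 hq, h]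
    exact tendsto_row_sum hK hq0.le hq (fun N b hb0 _ => hb' b N N (by nlinarith))
      (tendsto_cullenForm_zero_left hq0 hq)

/-! ### The closed form behind Zhao's series and its summation -/

/-- The polynomial occurring in the WZ form behind Zhao's series; it is divisible by `q - 1`. -/
noncomputable def zhaoKappa (q A C : ℝ) : ℝ :=
  q * (1 - q * A ^ 2 * C) * (1 + q * A) * (1 - A) ^ 3 * (1 - A * C) -
    (1 - q * A ^ 2) * (1 - A ^ 2 * C) * (1 - q * A * C) * (1 - q * A) ^ 2

/-- The product underlying the WZ form behind Zhao's series. -/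
noncomputable def zhaoKernel (q : ℝ) (a c : ℕ) : ℝ :=
  (-1) ^ c * (q ^ (2 * a * c) / q ^ c ^ 2) * qPoch (q ^ 2) (q ^ 2) (2 * a + c) *
      qPoch q (q ^ 2) (a + c) * qPoch q (q ^ 2) a ^ 6 * qPoch q (q ^ 2) c ^ 4 /
    (qPoch (q ^ 2) (q ^ 2) c * qPoch (q ^ 2) (q ^ 2) (2 * a) * qPoch (q ^ 2) (q ^ 2) a ^ 4 *
      qPoch (q ^ 2) (q ^ 2) (a + c) ^ 4)

/-- The rational factor of `zhaoHor`, with `A = q ^ (2 a)` and `C = q ^ (2 c)`. -/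
noncomputable def zhaoHorRat (q A C : ℝ) : ℝ :=
  (1 - C) * zhaoKappa q A C / ((q - 1) * (1 - A ^ 2 * C) * (1 + q * A))

/-- The rational factor of `zhaoVert`, with `A = q ^ (2 a)` and `C = q ^ (2 c)`. -/
noncomputable def zhaoVertRat (q A C : ℝ) : ℝ :=
  (1 - q * A * C ^ 2) * (1 - A ^ 2) * (1 - A) ^ 4 / (1 - A ^ 2 * C)

/-- The horizontal component of the discrete closed `1`-form behind Zhao's series. -/
noncomputable def zhaoHor (q : ℝ) (a c : ℕ) : ℝ :=
  zhaoHorRat q (q ^ (2 * a)) (q ^ (2 * c)) * qPoch q (q ^ 2) (a - c) * zhaoKernel q a c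

/-- The vertical component of the discrete closed `1`-form behind Zhao's series. -/
noncomputable def zhaoVert (q : ℝ) (a c : ℕ) : ℝ :=
  zhaoVertRat q (q ^ (2 * a)) (q ^ (2 * c)) * qPoch q (q ^ 2) (a - c - 1) * zhaoKernel q a c

theorem zhaoKernel_succ_right (q : ℝ) (a c : ℕ) :
    zhaoKernel q a (c + 1) = zhaoKernel q a c *
      (-(q ^ (2 * a) / (q * q ^ (2 * c))) * (1 - q ^ 2 * (q ^ (2 * a)) ^ 2 * q ^ (2 * c)) *
        (1 - q * q ^ (2 * a) * q ^ (2 * c)) * (1 - q * q ^ (2 * c)) ^ 4 /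
        ((1 - q ^ 2 * q ^ (2 * c)) * (1 - q ^ 2 * q ^ (2 * a) * q ^ (2 * c)) ^ 4)) := by
  have p1 : qPoch (q ^ 2) (q ^ 2) (2 * a + (c + 1)) = qPoch (q ^ 2) (q ^ 2) (2 * a + c) *
      (1 - q ^ 2 * (q ^ (2 * a)) ^ 2 * q ^ (2 * c)) := by
    rw [← add_assoc, qPoch_succ]; ring
  have p2 : qPoch (q ^ 2) (q ^ 2) (a + (c + 1)) = qPoch (q ^ 2) (q ^ 2) (a + c) *
      (1 - q ^ 2 * q ^ (2 * a) * q ^ (2 * c)) := by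
    rw [← add_assoc, qPoch_succ]; ring
  have p3 : qPoch q (q ^ 2) (a + (c + 1)) = qPoch q (q ^ 2) (a + c) *
      (1 - q * q ^ (2 * a) * q ^ (2 * c)) := by
    rw [← add_assoc, qPoch_succ]; ring
  have p4 : qPoch q (q ^ 2) (c + 1) = qPoch q (q ^ 2) c * (1 - q * q ^ (2 * c)) := by
    rw [qPoch_succ, ← pow_mul]
  have p5 : qPoch (q ^ 2) (q ^ 2) (c + 1) = qPoch (q ^ 2) (q ^ 2) c *
      (1 - q ^ 2 * q ^ (2 * c)) := by
    rw [qPoch_succ, ← pow_mul]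
  have p6 : q ^ (2 * a * (c + 1)) / q ^ (c + 1) ^ 2 =
      q ^ (2 * a * c) / q ^ c ^ 2 * (q ^ (2 * a) / (q * q ^ (2 * c))) := by
    rw [div_mul_div_comm, show 2 * a * (c + 1) = 2 * a * c + 2 * a by ring,
      show (c + 1) ^ 2 = c ^ 2 + (1 + 2 * c) by ring, pow_add, pow_add, pow_add, pow_one]
  unfold zhaoKernel
  rw [p1, p2, p3, p4, p5, p6, pow_succ (-1 : ℝ)]
  generalize q ^ (2 * a * c) / q ^ c ^ 2 = z
  generalize q ^ (2 * a) / (q * q ^ (2 * c)) = z'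
  rw [div_mul_div_comm]
  congr 1 <;> ring

theorem zhaoKernel_succ_left (q : ℝ) (a c : ℕ) :
    zhaoKernel q (a + 1) c = zhaoKernel q a c *
      (q ^ (2 * c) * (1 - q ^ 2 * (q ^ (2 * a)) ^ 2 * q ^ (2 * c)) *
        (1 - q ^ 4 * (q ^ (2 * a)) ^ 2 * q ^ (2 * c)) *
        (1 - q * q ^ (2 * a) * q ^ (2 * c)) * (1 - q * q ^ (2 * a)) ^ 6 /
        ((1 - q ^ 2 * (q ^ (2 * a)) ^ 2) * (1 - q ^ 4 * (q ^ (2 * a)) ^ 2) *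
          (1 - q ^ 2 * q ^ (2 * a)) ^ 4 * (1 - q ^ 2 * q ^ (2 * a) * q ^ (2 * c)) ^ 4)) := by
  have p1 : qPoch (q ^ 2) (q ^ 2) (2 * (a + 1) + c) = qPoch (q ^ 2) (q ^ 2) (2 * a + c) *
      (1 - q ^ 2 * (q ^ (2 * a)) ^ 2 * q ^ (2 * c)) *
      (1 - q ^ 4 * (q ^ (2 * a)) ^ 2 * q ^ (2 * c)) := by
    rw [show 2 * (a + 1) + c = 2 * a + c + 1 + 1 by ring, qPoch_succ, qPoch_succ]; ring
  have p2 : qPoch (q ^ 2) (q ^ 2) (a + 1 + c) = qPoch (q ^ 2) (q ^ 2) (a + c) *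
      (1 - q ^ 2 * q ^ (2 * a) * q ^ (2 * c)) := by
    rw [add_right_comm, qPoch_succ]; ring
  have p3 : qPoch q (q ^ 2) (a + 1 + c) = qPoch q (q ^ 2) (a + c) *
      (1 - q * q ^ (2 * a) * q ^ (2 * c)) := by
    rw [add_right_comm, qPoch_succ]; ring
  have p4 : qPoch q (q ^ 2) (a + 1) = qPoch q (q ^ 2) a * (1 - q * q ^ (2 * a)) := by
    rw [qPoch_succ, ← pow_mul]
  have p5 : qPoch (q ^ 2) (q ^ 2) (a + 1) = qPoch (q ^ 2) (q ^ 2) a *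
      (1 - q ^ 2 * q ^ (2 * a)) := by
    rw [qPoch_succ, ← pow_mul]
  have p6 : qPoch (q ^ 2) (q ^ 2) (2 * (a + 1)) = qPoch (q ^ 2) (q ^ 2) (2 * a) *
      (1 - q ^ 2 * (q ^ (2 * a)) ^ 2) * (1 - q ^ 4 * (q ^ (2 * a)) ^ 2) := by
    rw [show 2 * (a + 1) = 2 * a + 1 + 1 by ring, qPoch_succ, qPoch_succ]; ring
  have p7 : q ^ (2 * (a + 1) * c) / q ^ c ^ 2 =
      q ^ (2 * a * c) / q ^ c ^ 2 * q ^ (2 * c) := by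
    rw [div_mul_eq_mul_div, show 2 * (a + 1) * c = 2 * a * c + 2 * c by ring, pow_add]
  unfold zhaoKernel
  rw [p1, p2, p3, p4, p5, p6, p7]
  generalize q ^ (2 * a * c) / q ^ c ^ 2 = z
  rw [div_mul_div_comm]
  congr 1 <;> ring

/-- The polynomial identity expressing that the form `(zhaoHor, zhaoVert)` is closed. -/
theorem zhaoKappa_closed (q A C : ℝ) :
    -A * (1 - q * A * C) * (1 - q * C) ^ 4 * zhaoKappa q A (q ^ 2 * C) * (1 - A ^ 2 * C) -
        (q * C - A) * (1 - C) * zhaoKappa q A C * (1 - q ^ 2 * A * C) ^ 4 =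
      (q - 1) * ((q * C - A) * C * (1 - q ^ 2 * A ^ 2 * C) * (1 - q * A * C) * (1 - q * A) ^ 5 *
          (1 - q ^ 3 * A * C ^ 2) * (1 - A ^ 2 * C) -
        q * C * (1 - q * A * C ^ 2) * (1 - A ^ 2) * (1 - A) ^ 4 * (1 + q * A) *
          (1 - q ^ 2 * A * C) ^ 4) := by
  unfold zhaoKappa
  ring

/-- Clearing denominators leaves `zhaoKappa_closed`. The factor 1 - A/(qC) is the last factor of
(q;q²)_{a-c}, the part of the form not contained in the kernel. -/
theorem zhaoRat_closed {q A C : ℝ} (hq : q ≠ 0) (hq1 : q - 1 ≠ 0) (hC : C ≠ 0)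
    (h1 : 1 - A ^ 2 * C ≠ 0) (h2 : 1 + q * A ≠ 0)
    (h4 : 1 - q ^ 2 * A * C ≠ 0) (h5 : 1 - q ^ 2 * C ≠ 0) (h6 : 1 - q ^ 2 * A ≠ 0)
    (h7 : 1 - q ^ 4 * A ^ 2 ≠ 0) (h8 : 1 - q ^ 2 * A ^ 2 * C ≠ 0)
    (h9 : 1 - q ^ 4 * A ^ 2 * C ≠ 0) :
    zhaoHorRat q A (q ^ 2 * C) *
        (-(A / (q * C)) * (1 - q ^ 2 * A ^ 2 * C) * (1 - q * A * C) * (1 - q * C) ^ 4 /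
          ((1 - q ^ 2 * C) * (1 - q ^ 2 * A * C) ^ 4)) -
        zhaoHorRat q A C * (1 - A / (q * C)) =
      zhaoVertRat q (q ^ 2 * A) C * (1 - A / (q * C)) *
        (C * (1 - q ^ 2 * A ^ 2 * C) * (1 - q ^ 4 * A ^ 2 * C) * (1 - q * A * C) *
          (1 - q * A) ^ 6 / ((1 - q ^ 2 * A ^ 2) * (1 - q ^ 4 * A ^ 2) * (1 - q ^ 2 * A) ^ 4 *
          (1 - q ^ 2 * A * C) ^ 4)) - zhaoVertRat q A C := by
  have main := zhaoKappa_closed q A C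
  have hd : 1 - A / (q * C) = (q * C - A) / (q * C) := by field_simp
  rw [hd]
  unfold zhaoHorRat zhaoVertRat
  rw [show 1 - A ^ 2 * (q ^ 2 * C) = 1 - q ^ 2 * A ^ 2 * C by ring,
    show 1 - (q ^ 2 * A) ^ 2 * C = 1 - q ^ 4 * A ^ 2 * C by ring,
    show 1 - (q ^ 2 * A) ^ 2 = 1 - q ^ 4 * A ^ 2 by ring,
    show 1 - q ^ 2 * A ^ 2 = (1 - q * A) * (1 + q * A) by ring,
    show 1 - q * (q ^ 2 * A) * C ^ 2 = 1 - q ^ 3 * A * C ^ 2 by ring]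
  generalize zhaoKappa q A (q ^ 2 * C) = k1 at *
  generalize zhaoKappa q A C = k2 at *
  generalize 1 - A ^ 2 * C = y1 at *
  generalize 1 + q * A = y2 at *
  generalize 1 - q * A = y3 at *
  generalize 1 - q ^ 2 * A * C = y4 at *
  generalize 1 - q ^ 2 * C = y5 at *
  generalize 1 - q ^ 2 * A = y6 at *
  generalize 1 - q ^ 4 * A ^ 2 = y7 at *
  generalize 1 - q ^ 2 * A ^ 2 * C = y8 at *
  generalize 1 - q ^ 4 * A ^ 2 * C = y9 at *
  generalize 1 - q * A * C = z1 at *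
  generalize 1 - q * C = z2 at *
  generalize 1 - q ^ 3 * A * C ^ 2 = z3 at *
  generalize 1 - q * A * C ^ 2 = z4 at *
  generalize 1 - A ^ 2 = z5 at *
  generalize 1 - A = z6 at *
  generalize 1 - C = z7 at *
  generalize q * C - A = z8 at *
  generalize q - 1 = z9 at *
  field_simp
  linear_combination main

theorem zhao_closed {q : ℝ} (hq0 : 0 < q) (hq : q < 1) (a c : ℕ) (h : c < a) :
    zhaoHor q a (c + 1) - zhaoHor q a c = zhaoVert q (a + 1) c - zhaoVert q a c := by
  -- Below the diagonal a = c + m + 1, so the truncated subtractions are genuine: the four edges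
  -- carry (q;q²)_m or (q;q²)_{m+1}, whose quotient is 1 - q^(2m+1) with q^(2m+1) = A/(qC).
  obtain ⟨m, rfl⟩ := Nat.exists_eq_add_of_lt h
  have hC : 0 < q ^ (2 * c) := by positivity
  have e : ∀ c : ℕ, q ^ (2 * (c + 1)) = q ^ 2 * q ^ (2 * c) := fun c => by ring
  have i1 : c + m + 1 - (c + 1) = m := by omega
  have i2 : c + m + 1 - c = m + 1 := by omega
  have i3 : c + m + 1 + 1 - c - 1 = m + 1 := by omega
  have p : qPoch q (q ^ 2) (m + 1) = qPoch q (q ^ 2) m *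
      (1 - q ^ (2 * (c + m + 1)) / (q * q ^ (2 * c))) := by
    rw [qPoch_succ]
    congr 2
    field_simp
    ring
  unfold zhaoHor zhaoVert
  rw [i1, i3, i2, Nat.add_sub_cancel, p, zhaoKernel_succ_right q,
    zhaoKernel_succ_left q (c + m + 1),
    e c, e (c + m + 1)]
  have n2 : ∀ i j : ℕ, i ≠ 0 → 1 - q ^ i * q ^ j ≠ 0 := fun i j hi => by
    rw [← pow_add]; exact (one_sub_pow_pos hq0 hq (by omega)).ne'
  have n3 : ∀ i j k : ℕ, i ≠ 0 → 1 - q ^ i * q ^ j * q ^ k ≠ 0 := fun i j k hi => by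
    rw [← pow_add, ← pow_add]; exact (one_sub_pow_pos hq0 hq (by omega)).ne'
  have := zhaoRat_closed (q := q) (A := q ^ (2 * (c + m + 1))) (C := q ^ (2 * c)) hq0.ne'
    (by linarith) hC.ne' (by rw [← pow_mul]; exact n2 _ _ (by omega)) (by positivity)
    (n3 _ _ _ two_ne_zero) (n2 _ _ two_ne_zero) (n2 _ _ two_ne_zero)
    (by rw [← pow_mul]; exact n2 _ _ four_ne_zero)
    (by rw [← pow_mul]; exact n3 _ _ _ two_ne_zero)
    (by rw [← pow_mul]; exact n3 _ _ _ four_ne_zero)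
  generalize zhaoKernel q (c + m + 1) c = w at *
  generalize qPoch q (q ^ 2) m = w' at *
  generalize q ^ (2 * (c + m + 1)) = A at *
  generalize q ^ (2 * c) = C at *
  generalize zhaoHorRat q A (q ^ 2 * C) = r1 at *
  generalize zhaoHorRat q A C = r2 at *
  generalize zhaoVertRat q (q ^ 2 * A) C = r3 at *
  generalize zhaoVertRat q A C = r4 at *
  linear_combination w * w' * this

theorem zhaoHor_zero_right (q : ℝ) (a : ℕ) : zhaoHor q a 0 = 0 := by
  simp [zhaoHor, zhaoHorRat]

/-- Vertical plus horizontal numerator of a stair. The factor q - 1 stays on both sides because the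
quotient of `zhaoKappa` by q - 1 is not written out. -/
theorem zhaoPoly_eq (q : ℝ) (n : ℕ) :
    (q - 1) * zhaoPoly q n =
      (q - 1) * (q ^ (2 * n) * (1 - q ^ 2 * (q ^ (2 * n)) ^ 3) * (1 - q * (q ^ (2 * n)) ^ 2) *
        (1 - q * q ^ (2 * n)) * (1 - q ^ 3 * (q ^ (2 * n)) ^ 3) *
        (1 + q ^ (2 * n) + (q ^ (2 * n)) ^ 2)) +
      (1 + q * q ^ (2 * n)) ^ 4 * zhaoKappa q (q ^ (2 * n)) (q ^ (2 * n)) := by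
  unfold zhaoPoly zhaoKappa
  ring

theorem zhaoQTerm_eq {q : ℝ} (hq0 : 0 < q) (hq : q < 1) (n : ℕ) :
    zhaoQTerm q n = zhaoHor q n n + zhaoVert q (n + 1) n := by
  have hQ0 : 0 < q ^ 2 := by positivity
  have hQ : q ^ 2 < 1 := pow_lt_one₀ hq0.le hq two_ne_zero
  have hX : 0 < q ^ (2 * n) := by positivity
  have hq1 : q - 1 ≠ 0 := by linarith
  have h2 := (qPoch_pos hQ0 hQ hQ0 hQ (2 * n)).ne'
  have h3 := (qPoch_pos hQ0 hQ hQ0 hQ n).ne'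
  have n2 : ∀ i j : ℕ, i ≠ 0 → 1 - q ^ i * q ^ j ≠ 0 := fun i j hi => by
    rw [← pow_add]; exact (one_sub_pow_pos hq0 hq (by omega)).ne'
  have e1 : 1 - q * q ^ (2 * n) ≠ 0 := by
    rw [← pow_succ']; exact (one_sub_pow_pos hq0 hq (by omega)).ne'
  have e2 : 1 - q ^ 4 * (q ^ (2 * n)) ^ 2 ≠ 0 := by rw [← pow_mul]; exact n2 _ _ four_ne_zero
  have e3 : 1 + q * q ^ (2 * n) ≠ 0 := by positivity
  have e4 : 1 + q ^ (2 * n) + (q ^ (2 * n)) ^ 2 ≠ 0 := by positivity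
  have e5 : 1 - q ^ 4 * (q ^ (2 * n)) ^ 3 ≠ 0 := by rw [← pow_mul]; exact n2 _ _ four_ne_zero
  have e6 : 1 - q ^ 2 * q ^ (2 * n) ≠ 0 := n2 _ _ two_ne_zero
  have e : q ^ (2 * (n + 1)) = q ^ 2 * q ^ (2 * n) := by ring
  have k0 : zhaoKernel q n n = (-1) ^ n * q ^ (n ^ 2) * qPoch q (q ^ 2) (2 * n) *
      qPoch (q ^ 2) (q ^ 2) (3 * n) * qPoch q (q ^ 2) n ^ 10 /
      (qPoch (q ^ 2) (q ^ 2) n ^ 5 * qPoch (q ^ 2) (q ^ 2) (2 * n) ^ 5) := by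
    unfold zhaoKernel
    have : q ^ (2 * n * n) / q ^ n ^ 2 = q ^ n ^ 2 := by
      rw [div_eq_iff (by positivity), ← pow_add]; congr 1; ring
    rw [this, show 2 * n + n = 3 * n by ring, show n + n = 2 * n by ring]
    ring
  have hpoly : zhaoPoly q n = q ^ (2 * n) * (1 - q ^ 2 * (q ^ (2 * n)) ^ 3) *
        (1 - q * (q ^ (2 * n)) ^ 2) *
        (1 - q * q ^ (2 * n)) * (1 - q ^ 3 * (q ^ (2 * n)) ^ 3) *
        (1 + q ^ (2 * n) + (q ^ (2 * n)) ^ 2) +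
      (1 + q * q ^ (2 * n)) ^ 4 * (zhaoKappa q (q ^ (2 * n)) (q ^ (2 * n)) / (q - 1)) := by
    have := zhaoPoly_eq q n
    field_simp
    linear_combination this
  have hhor : zhaoHorRat q (q ^ (2 * n)) (q ^ (2 * n)) =
      (zhaoKappa q (q ^ (2 * n)) (q ^ (2 * n)) / (q - 1)) /
        ((1 + q ^ (2 * n) + (q ^ (2 * n)) ^ 2) * (1 + q * q ^ (2 * n))) := by
    -- For n = 0 the factor 1 - q^(2n) to be cancelled is zero; both sides are then 0, since 1 - C
    -- and `zhaoKappa q 1 1` vanish.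
    rcases Nat.eq_zero_or_pos n with rfl | hn
    · simp [zhaoHorRat, zhaoKappa]
    · have hX1 : 1 - q ^ (2 * n) ≠ 0 := (one_sub_pow_pos hq0 hq (by omega)).ne'
      unfold zhaoHorRat
      rw [show 1 - (q ^ (2 * n)) ^ 2 * q ^ (2 * n) =
        (1 - q ^ (2 * n)) * (1 + q ^ (2 * n) + (q ^ (2 * n)) ^ 2) by ring]
      generalize 1 + q ^ (2 * n) + (q ^ (2 * n)) ^ 2 = y at *
      generalize 1 + q * q ^ (2 * n) = y2 at *
      generalize 1 - q ^ (2 * n) = y3 at *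
      field_simp
  have hden : (q ^ (2 * n) - q ^ n + 1) * (q ^ (2 * n) + q ^ n + 1) =
      1 + q ^ (2 * n) + (q ^ (2 * n)) ^ 2 := by ring
  unfold zhaoHor zhaoVert
  rw [zhaoKernel_succ_left q, Nat.sub_self, show n + 1 - n - 1 = 0 by omega, qPoch_zero,
    hhor, k0, zhaoQTerm, hden, hpoly, e, zhaoVertRat,
    show q ^ (2 * n + 1) = q * q ^ (2 * n) by ring]
  generalize zhaoKappa q (q ^ (2 * n)) (q ^ (2 * n)) / (q - 1) = κ
  generalize q ^ (2 * n) = X at *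
  rw [show 1 - q ^ 2 * X ^ 2 * X = 1 - q ^ 2 * X ^ 3 by ring,
    show 1 - q ^ 4 * X ^ 2 * X = 1 - q ^ 4 * X ^ 3 by ring,
    show 1 - q * X * X = 1 - q * X ^ 2 by ring,
    show 1 - q ^ 2 * X ^ 2 = (1 - q * X) * (1 + q * X) by ring,
    show 1 - q ^ 2 * X * X = (1 - q * X) * (1 + q * X) by ring,
    show 1 - (q ^ 2 * X) ^ 2 * X = 1 - q ^ 4 * X ^ 3 by ring,
    show 1 - (q ^ 2 * X) ^ 2 = 1 - q ^ 4 * X ^ 2 by ring,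
    show 1 - q * (q ^ 2 * X) * X ^ 2 = 1 - q ^ 3 * X ^ 3 by ring,
    add_comm (q * X) 1]
  generalize 1 - q * X = y1 at *
  generalize 1 + q * X = y2 at *
  generalize 1 - q ^ 4 * X ^ 2 = y3 at *
  generalize 1 - q ^ 4 * X ^ 3 = y4 at *
  generalize 1 - q ^ 2 * X = y5 at *
  generalize 1 + X + X ^ 2 = y6 at *
  generalize 1 - q * X ^ 2 = y7 at *
  generalize 1 - q ^ 3 * X ^ 3 = y8 at *
  generalize 1 - q ^ 2 * X ^ 3 = y9 at *
  field_simp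
  ring

/-- The exponent m stands for any lower bound of 2ac - c², which avoids truncated subtraction. -/
theorem abs_zhaoKernel_le {q : ℝ} (hq0 : 0 < q) (hq : q < 1) {a c m : ℕ}
    (hm : m + c ^ 2 ≤ 2 * a * c) :
    |zhaoKernel q a c| ≤ q ^ m / qPochInf (q ^ 2) (q ^ 2) ^ 10 := by
  have hQ0 : 0 < q ^ 2 := by positivity
  have hQ : q ^ 2 < 1 := pow_lt_one₀ hq0.le hq two_ne_zero
  have hL := qPochInf_pos hQ0 hQ hQ0 hQ
  have hle := qPochInf_le_qPoch hQ0 hQ hQ0 hQ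
  set L := qPochInf (q ^ 2) (q ^ 2)
  have hp := qPoch_pos hQ0 hQ hQ0 hQ
  have hp' := qPoch_pos hq0 hq hQ0 hQ
  have h1 := qPoch_le_one hQ0 hQ hQ0 hQ
  have h1' := qPoch_le_one hq0 hq hQ0 hQ
  have hpow : q ^ (2 * a * c) / q ^ c ^ 2 ≤ q ^ m := by
    rw [div_le_iff₀ (by positivity), ← pow_add]
    exact pow_le_pow_of_le_one hq0.le hq.le hm
  have n1 := hp (2 * a + c)
  have n2 := hp' (a + c)
  have n3 := hp' a
  have n4 := hp' c
  have n5 := hp c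
  have n6 := hp (2 * a)
  have n7 := hp a
  have n8 := hp (a + c)
  unfold zhaoKernel
  rw [abs_div, abs_mul, abs_mul, abs_mul, abs_mul, abs_mul, abs_pow, abs_neg, abs_one, one_pow,
    one_mul, abs_of_nonneg (by positivity : 0 ≤ q ^ (2 * a * c) / q ^ c ^ 2), abs_of_pos n1,
    abs_of_pos n2, abs_of_pos (pow_pos n3 6), abs_of_pos (pow_pos n4 4),
    abs_of_pos (by positivity)]
  calc _ ≤ q ^ m * 1 * 1 * 1 ^ 6 * 1 ^ 4 / (L * L * L ^ 4 * L ^ 4) := by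
        gcongr
        exacts [h1 _, h1' _, h1' _, h1' _, hle _, hle _, hle _, hle _]
    _ = _ := by ring

theorem abs_one_sub_le_one {x : ℝ} (h0 : 0 ≤ x) (h1 : x ≤ 1) : |1 - x| ≤ 1 := by
  rw [abs_le]; constructor <;> linarith

theorem abs_zhaoHorRat_le {q A C : ℝ} (hq0 : 0 < q) (hq : q < 1) (hA0 : 0 ≤ A) (hA : A ≤ 1)
    (hC0 : 0 ≤ C) (hC : C ≤ 1) : |zhaoHorRat q A C| ≤ 3 / (1 - q) := by
  have hAC0 : 0 ≤ A * C := by positivity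
  have hAC : A * C ≤ 1 := mul_le_one₀ hA hC0 hC
  have hA2 : A ^ 2 ≤ 1 := pow_le_one₀ hA0 hA
  have hAAC : A ^ 2 * C ≤ C := mul_le_of_le_one_left hC0 hA2
  have hAAC0 : 0 ≤ A ^ 2 * C := by positivity
  have hqA : q * A ≤ 1 := mul_le_one₀ hq.le hA0 hA
  have hqA0 : 0 ≤ q * A := by positivity
  -- The denominator may be arbitrarily small, but 1 - C ≤ 1 - A²C; in the case 0/0 the quotient is
  -- 0.
  have hr : |(1 - C) / (1 - A ^ 2 * C)| ≤ 1 := by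
    rw [abs_of_nonneg (div_nonneg (by linarith) (by linarith))]
    exact div_le_one_of_le₀ (by linarith) (by linarith)
  have hk : |zhaoKappa q A C| ≤ 3 := by
    have b1 := abs_one_sub_le_one (x := q * A ^ 2 * C) (by positivity)
      (by rw [mul_assoc]; exact mul_le_one₀ hq.le hAAC0 (by linarith))
    have b2 : |1 + q * A| ≤ 2 := by rw [abs_of_nonneg (by positivity)]; linarith
    have b3 := abs_one_sub_le_one hA0 hA
    have b4 := abs_one_sub_le_one hAC0 hAC
    have b5 := abs_one_sub_le_one (x := q * A ^ 2) (by positivity)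
      (mul_le_one₀ hq.le (by positivity) hA2)
    have b6 := abs_one_sub_le_one hAAC0 (by linarith)
    have b7 := abs_one_sub_le_one (x := q * A * C) (by positivity) (mul_le_one₀ hqA hC0 hC)
    have b8 := abs_one_sub_le_one hqA0 hqA
    unfold zhaoKappa
    refine (abs_sub _ _).trans ?_
    simp only [abs_mul, abs_pow, abs_of_pos hq0]
    calc _ ≤ (1 : ℝ) * 1 * 2 * 1 ^ 3 * 1 + 1 * 1 * 1 * 1 ^ 2 := by gcongr
      _ = 3 := by norm_num
  have h1q : 0 < 1 - q := by linarith
  have e : zhaoHorRat q A C = -((1 - C) / (1 - A ^ 2 * C) * zhaoKappa q A C /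
      ((1 - q) * (1 + q * A))) := by
    unfold zhaoHorRat
    rw [← neg_sub 1 q, div_mul_eq_mul_div, div_div, ← div_neg]
    congr 1
    ring
  rw [e, abs_neg, abs_div, abs_mul, abs_of_pos (by positivity : 0 < (1 - q) * (1 + q * A))]
  calc _ ≤ 1 * 3 / ((1 - q) * 1) := by
        gcongr
        linarith
    _ = _ := by ring

/-- Here A ≤ q, available for a ≥ 1, keeps the denominator 1 - A²C at least 1 - q. -/
theorem abs_zhaoVertRat_le {q A C : ℝ} (hq0 : 0 < q) (hq : q < 1) (hA0 : 0 ≤ A) (hA : A ≤ q)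
    (hC0 : 0 ≤ C) (hC : C ≤ 1) : |zhaoVertRat q A C| ≤ 1 / (1 - q) := by
  have h1q : 0 < 1 - q := by linarith
  have hA1 : A ≤ 1 := by linarith
  have hC2 : C ^ 2 ≤ 1 := pow_le_one₀ hC0 hC
  have b1 := abs_one_sub_le_one (x := q * A * C ^ 2) (by positivity)
    (mul_le_one₀ (mul_le_one₀ hq.le hA0 hA1) (by positivity) hC2)
  have b2 := abs_one_sub_le_one (x := A ^ 2) (by positivity) (pow_le_one₀ hA0 hA1)
  have b3 := abs_one_sub_le_one hA0 hA1
  have b4 : 1 - q ≤ |1 - A ^ 2 * C| := by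
    have : A ^ 2 * C ≤ A := by
      have : A * C ≤ 1 := mul_le_one₀ hA1 hC0 hC
      nlinarith
    exact le_trans (by linarith) (le_abs_self _)
  unfold zhaoVertRat
  rw [abs_div, abs_mul, abs_mul, abs_pow]
  calc _ ≤ 1 * 1 * 1 ^ 4 / (1 - q) := by gcongr
    _ = _ := by ring

theorem exists_abs_zhao_le {q : ℝ} (hq0 : 0 < q) (hq : q < 1) :
    ∃ K : ℝ, 0 ≤ K ∧ ∀ a c m : ℕ, m + c ^ 2 ≤ 2 * a * c → |zhaoHor q a c| ≤ K * q ^ m ∧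
      (a ≠ 0 → |zhaoVert q a c| ≤ K * q ^ m) := by
  have hQ0 : 0 < q ^ 2 := by positivity
  have hQ : q ^ 2 < 1 := pow_lt_one₀ hq0.le hq two_ne_zero
  have hL := qPochInf_pos hQ0 hQ hQ0 hQ
  have h1q : 0 < 1 - q := by linarith
  have hp : ∀ n, |qPoch q (q ^ 2) n| ≤ 1 := fun n => by
    rw [abs_of_pos (qPoch_pos hq0 hq hQ0 hQ n)]
    exact qPoch_le_one hq0 hq hQ0 hQ n
  refine ⟨3 / (1 - q) / qPochInf (q ^ 2) (q ^ 2) ^ 10, by positivity, fun a c m hm => ?_⟩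
  have hk := abs_zhaoKernel_le hq0 hq hm
  have hC : q ^ (2 * c) ≤ 1 := pow_le_one₀ hq0.le hq.le
  set L := qPochInf (q ^ 2) (q ^ 2)
  refine ⟨?_, fun ha => ?_⟩
  · have hr := abs_zhaoHorRat_le hq0 hq (A := q ^ (2 * a)) (C := q ^ (2 * c)) (by positivity)
      (pow_le_one₀ hq0.le hq.le) (by positivity) hC
    unfold zhaoHor
    rw [abs_mul, abs_mul]
    calc _ ≤ 3 / (1 - q) * 1 * (q ^ m / L ^ 10) := by
          gcongr
          exact hp _
      _ = _ := by ring
  · have hr := abs_zhaoVertRat_le hq0 hq (A := q ^ (2 * a)) (C := q ^ (2 * c)) (by positivity)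
      (pow_le_of_le_one hq0.le hq.le (by omega)) (by positivity) hC
    unfold zhaoVert
    rw [abs_mul, abs_mul]
    calc _ ≤ 1 / (1 - q) * 1 * (q ^ m / L ^ 10) := by
          gcongr
          exact hp _
      _ ≤ 3 / (1 - q) * 1 * (q ^ m / L ^ 10) := by gcongr; norm_num
      _ = _ := by ring

/-- At c = 0 the kernel has only seven powers of (q;q²)_N; the eighth comes from (q;q²)_{N-1}, which
has the same limit. -/
theorem tendsto_zhaoVert_zero_right {q : ℝ} (hq0 : 0 < q) (hq : q < 1) :
    Tendsto (fun N => zhaoVert q N 0) atTop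
      (𝓝 ((qPochInf q (q ^ 2) / qPochInf (q ^ 2) (q ^ 2)) ^ 8)) := by
  have hQ0 : 0 < q ^ 2 := by positivity
  have hQ : q ^ 2 < 1 := pow_lt_one₀ hq0.le hq two_ne_zero
  have hL := qPochInf_pos hQ0 hQ hQ0 hQ
  have hX := tendsto_pow_two_mul hq0 hq
  have hrat : Tendsto (fun N : ℕ => zhaoVertRat q (q ^ (2 * N)) (q ^ (2 * 0))) atTop (𝓝 1) := by
    have hc : ContinuousAt (fun A : ℝ => zhaoVertRat q A (q ^ (2 * 0))) 0 := by
      unfold zhaoVertRat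
      have : 1 - (0 : ℝ) ^ 2 * q ^ (2 * 0) ≠ 0 := by norm_num
      fun_prop (disch := exact this)
    have h := hc.tendsto.comp hX
    have h0 : zhaoVertRat q 0 (q ^ (2 * 0)) = 1 := by simp [zhaoVertRat]
    rw [h0] at h
    exact h
  have hker : Tendsto (fun N : ℕ => zhaoKernel q N 0) atTop
      (𝓝 (qPochInf q (q ^ 2) ^ 7 / qPochInf (q ^ 2) (q ^ 2) ^ 8)) := by
    have : ∀ N, zhaoKernel q N 0 = qPoch q (q ^ 2) N ^ 7 / qPoch (q ^ 2) (q ^ 2) N ^ 8 := by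
      intro N
      have h1 := (qPoch_pos hQ0 hQ hQ0 hQ (2 * N)).ne'
      simp [zhaoKernel, qPoch_zero]
      field_simp
    simp_rw [this]
    exact ((tendsto_qPoch q hQ0 hQ).pow 7).div ((tendsto_qPoch (q ^ 2) hQ0 hQ).pow 8)
      (pow_ne_zero 8 hL.ne')
  have hpred : Tendsto (fun N : ℕ => qPoch q (q ^ 2) (N - 0 - 1)) atTop
      (𝓝 (qPochInf q (q ^ 2))) :=
    (tendsto_qPoch q hQ0 hQ).comp (tendsto_sub_atTop_nat 1)
  have h := (hrat.mul hpred).mul hker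
  have e : 1 * qPochInf q (q ^ 2) * (qPochInf q (q ^ 2) ^ 7 / qPochInf (q ^ 2) (q ^ 2) ^ 8) =
      (qPochInf q (q ^ 2) / qPochInf (q ^ 2) (q ^ 2)) ^ 8 := by ring
  rw [e] at h
  exact h

theorem hasSum_zhaoQTerm {q : ℝ} (hq0 : 0 < q) (hq : q < 1) :
    HasSum (zhaoQTerm q) ((1 - q ^ 2) ^ 4 / qGamma (q ^ 2) (1 / 2) ^ 8) := by
  rw [one_sub_pow_div_qGamma_half hq0 hq]
  obtain ⟨K, hK, hb⟩ := exists_abs_zhao_le hq0 hq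
  refine hasSum_of_abs_le_of_tendsto_sum_range (K := 2 * K) hq0.le hq (fun n => ?_) ?_
  · rw [zhaoQTerm_eq hq0 hq]
    refine (abs_add_le _ _).trans ?_
    linarith [(hb n n n (by nlinarith [Nat.le_mul_self n])).1,
      (hb (n + 1) n n (by nlinarith [Nat.le_mul_self n])).2 n.succ_ne_zero]
  · simp_rw [zhaoQTerm_eq hq0 hq, sum_staircase_eq (zhaoHor_zero_right q)
      fun a c h => zhao_closed hq0 hq a c h]
    refine tendsto_row_sum hK hq0.le hq (fun N b hb0 hbN => ?_)
      (tendsto_zhaoVert_zero_right hq0 hq)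
    -- The exponent N is admissible because 2Nb - b² - N = b(N - b) + N(b - 1) ≥ 0 for 1 ≤ b < N.
    refine (hb N b N ?_).2 (by omega)
    obtain ⟨m, rfl⟩ := Nat.exists_eq_add_of_lt hbN
    obtain ⟨c, rfl⟩ := Nat.exists_eq_add_of_lt hb0
    nlinarith [Nat.zero_le (c * m), Nat.zero_le (c * c)]

/-! ### Limits of q-factorials as q → 1⁻ -/

theorem eventually_mem_Ioo_nhdsLT_one : ∀ᶠ q : ℝ in 𝓝[<] 1, 0 < q ∧ q < 1 := by
  filter_upwards [Ioo_mem_nhdsLT (show (0 : ℝ) < 1 by norm_num)] with q hq using hq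

theorem Continuous.tendsto_nhdsLT_one {f : ℝ → ℝ} (hf : Continuous f) :
    Tendsto f (𝓝[<] 1) (𝓝 (f 1)) :=
  (hf.tendsto 1).mono_left nhdsWithin_le_nhds

theorem tendsto_one_sub_pow_div (j : ℕ) :
    Tendsto (fun q : ℝ => (1 - q ^ j) / (1 - q ^ 2)) (𝓝[<] 1) (𝓝 ((j : ℝ) / 2)) := by
  have h : Tendsto (fun q : ℝ => (∑ i ∈ Finset.range j, q ^ i) / (1 + q)) (𝓝[<] 1)
      (𝓝 ((j : ℝ) / 2)) := by
    have h1 : Tendsto (fun q : ℝ => ∑ i ∈ Finset.range j, q ^ i) (𝓝[<] 1) (𝓝 j) := by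
      simpa using Continuous.tendsto_nhdsLT_one
        (f := fun q : ℝ => ∑ i ∈ Finset.range j, q ^ i) (by fun_prop)
    have h2 : Tendsto (fun q : ℝ => 1 + q) (𝓝[<] 1) (𝓝 2) := by
      simpa [one_add_one_eq_two] using
        Continuous.tendsto_nhdsLT_one (f := fun q : ℝ => 1 + q) (by fun_prop)
    exact h1.div h2 two_ne_zero
  refine h.congr' ?_
  filter_upwards [eventually_mem_Ioo_nhdsLT_one] with q hq
  have h1 : 1 - q ≠ 0 := by linarith [hq.2]
  have h2 : 1 + q ≠ 0 := by linarith [hq.1]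
  rw [← mul_neg_geom_sum, show 1 - q ^ 2 = (1 - q) * (1 + q) by ring,
    mul_div_mul_left _ _ h1]

theorem risingFac_zero (a : ℝ) : risingFac a 0 = 1 := by simp [risingFac]

theorem risingFac_succ (a : ℝ) (n : ℕ) : risingFac a (n + 1) = risingFac a n * (a + n) := by
  simp [risingFac, ascPochhammer_succ_eval]

theorem risingFac_pos {a : ℝ} (ha : 0 < a) (n : ℕ) : 0 < risingFac a n :=
  ascPochhammer_pos n a ha

theorem tendsto_qPoch_div_pow (i n : ℕ) :
    Tendsto (fun q : ℝ => qPoch (q ^ i) (q ^ 2) n / (1 - q ^ 2) ^ n) (𝓝[<] 1)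
      (𝓝 (risingFac ((i : ℝ) / 2) n)) := by
  induction n with
  | zero => simp [qPoch_zero, risingFac_zero]
  | succ n ih =>
    have h := ih.mul (tendsto_one_sub_pow_div (i + 2 * n))
    rw [risingFac_succ, show (i / 2 + n : ℝ) = ((i + 2 * n : ℕ) : ℝ) / 2 by push_cast; ring]
    refine h.congr fun q => ?_
    rw [qPoch_succ, div_mul_div_comm, ← pow_succ, pow_add, pow_mul]

theorem tendsto_qPoch_base_div_pow (n : ℕ) :
    Tendsto (fun q : ℝ => qPoch (q ^ 2) (q ^ 2) n / (1 - q ^ 2) ^ n) (𝓝[<] 1)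
      (𝓝 (risingFac 1 n)) := by
  simpa using tendsto_qPoch_div_pow 2 n

theorem tendsto_qPoch_half_div_pow (n : ℕ) :
    Tendsto (fun q : ℝ => qPoch q (q ^ 2) n / (1 - q ^ 2) ^ n) (𝓝[<] 1)
      (𝓝 (risingFac (1 / 2) n)) := by
  simpa using tendsto_qPoch_div_pow 1 n

/-! ### Multiplication formulas for rising factorials -/

theorem risingFac_one_two_mul (n : ℕ) :
    risingFac 1 (2 * n) = 4 ^ n * risingFac 1 n * risingFac (1 / 2) n := by
  induction n with
  | zero => simp [risingFac_zero]
  | succ n ih =>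
    rw [show 2 * (n + 1) = 2 * n + 1 + 1 by ring]
    simp only [risingFac_succ, ih, pow_succ]
    push_cast
    ring

theorem risingFac_half_two_mul (n : ℕ) :
    risingFac (1 / 2) (2 * n) = 4 ^ n * risingFac (1 / 4) n * risingFac (3 / 4) n := by
  induction n with
  | zero => simp [risingFac_zero]
  | succ n ih =>
    rw [show 2 * (n + 1) = 2 * n + 1 + 1 by ring]
    simp only [risingFac_succ, ih, pow_succ]
    push_cast
    ring

theorem risingFac_one_three_mul (n : ℕ) :
    risingFac 1 (3 * n) =
      27 ^ n * risingFac 1 n * risingFac (1 / 3) n * risingFac (2 / 3) n := by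
  induction n with
  | zero => simp [risingFac_zero]
  | succ n ih =>
    rw [show 3 * (n + 1) = 3 * n + 1 + 1 + 1 by ring]
    simp only [risingFac_succ, ih, pow_succ]
    push_cast
    ring

theorem risingFac_one_four_mul (n : ℕ) :
    risingFac 1 (4 * n) = 256 ^ n * risingFac 1 n * risingFac (1 / 2) n * risingFac (1 / 4) n *
      risingFac (3 / 4) n := by
  rw [show 4 * n = 2 * (2 * n) by ring, risingFac_one_two_mul, risingFac_one_two_mul,
    risingFac_half_two_mul, show (256 : ℝ) = 4 ^ 2 * 4 * 4 by norm_num, mul_pow, mul_pow,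
    ← pow_mul]
  ring

/-! ### Termwise limits of the two series -/

/-- Expansion at U = W = 1 with no constant or linear term: a double zero, whose quadratic part
gives the limit in `tendsto_cullenTheta_div`. -/
theorem cullenTheta_eq (U W : ℝ) :
    cullenTheta U W = 2 * ((1 - U) + (1 - W)) ^ 2 - 2 * ((1 - U) * (1 - W)) -
      3 * ((1 - U) + (1 - W)) * ((1 - U) * (1 - W)) + ((1 - U) * (1 - W)) ^ 2 := by
  unfold cullenTheta
  ring

theorem tendsto_cullenTheta_div (i j : ℕ) :
    Tendsto (fun q : ℝ => cullenTheta (q ^ i) (q ^ j) / (1 - q ^ 2) ^ 2) (𝓝[<] 1)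
      (𝓝 (2 * ((i : ℝ) / 2 + j / 2) ^ 2 - 2 * ((i : ℝ) / 2 * (j / 2)))) := by
  have hi := tendsto_one_sub_pow_div i
  have hj := tendsto_one_sub_pow_div j
  have hd : Tendsto (fun q : ℝ => 1 - q ^ 2) (𝓝[<] 1) (𝓝 0) := by
    have h := Continuous.tendsto_nhdsLT_one (f := fun q : ℝ => 1 - q ^ 2) (by fun_prop)
    rwa [one_pow, sub_self] at h
  have h := ((((hi.add hj).pow 2).const_mul 2).sub ((hi.mul hj).const_mul 2)).sub
    ((((hi.add hj).const_mul 3).mul (hi.mul hj)).mul hd) |>.add (((hi.mul hj).pow 2).mul (hd.pow 2))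
  have e : (2 * ((i : ℝ) / 2 + j / 2) ^ 2 - 2 * ((i : ℝ) / 2 * (j / 2)) -
      3 * ((i : ℝ) / 2 + j / 2) * ((i : ℝ) / 2 * (j / 2)) * 0 +
      ((i : ℝ) / 2 * (j / 2)) ^ 2 * 0 ^ 2) =
      2 * ((i : ℝ) / 2 + j / 2) ^ 2 - 2 * ((i : ℝ) / 2 * (j / 2)) := by ring
  rw [e] at h
  refine h.congr' ?_
  filter_upwards [eventually_mem_Ioo_nhdsLT_one] with q hq
  have h1 : 1 - q ^ 2 ≠ 0 := (one_sub_pow_pos hq.1 hq.2 two_ne_zero).ne'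
  rw [cullenTheta_eq]
  generalize 1 - q ^ 2 = d at *
  field_simp

theorem tendsto_cullenPoly_div (n : ℕ) :
    Tendsto (fun q : ℝ => cullenPoly q n / (1 - q ^ 2) ^ 4) (𝓝[<] 1)
      (𝓝 ((43680 * (n : ℝ) ^ 4 + 20632 * n ^ 3 + 4340 * n ^ 2 + 466 * n + 21) / 2)) := by
  have c1 : Tendsto (fun q : ℝ => (1 + q * q ^ (2 * n)) ^ 8) (𝓝[<] 1)
      (𝓝 ((1 + 1 * 1 ^ (2 * n)) ^ 8)) :=
    Continuous.tendsto_nhdsLT_one (f := fun q : ℝ => (1 + q * q ^ (2 * n)) ^ 8) (by fun_prop)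
  have c2 : Tendsto (fun q : ℝ => (q ^ (2 * n)) ^ 2 * (1 + (q ^ (2 * n)) ^ 2)) (𝓝[<] 1)
      (𝓝 ((1 ^ (2 * n)) ^ 2 * (1 + (1 ^ (2 * n)) ^ 2))) :=
    Continuous.tendsto_nhdsLT_one
      (f := fun q : ℝ => (q ^ (2 * n)) ^ 2 * (1 + (q ^ (2 * n)) ^ 2)) (by fun_prop)
  have h := ((((tendsto_one_sub_pow_div (4 * n)).mul (tendsto_one_sub_pow_div (6 * n + 1))).mul
    (tendsto_cullenTheta_div (4 * n) (2 * n + 1))).mul c1).add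
    (((c2.mul (tendsto_one_sub_pow_div (8 * n + 2))).mul
    (tendsto_one_sub_pow_div (6 * n + 3))).mul (tendsto_cullenTheta_div (4 * n + 2) (2 * n + 1)))
  convert h.congr' ?_ using 2
  · push_cast
    simp only [one_pow]
    ring
  filter_upwards [eventually_mem_Ioo_nhdsLT_one] with q hq
  have h1 : 1 - q ^ 2 ≠ 0 := (one_sub_pow_pos hq.1 hq.2 two_ne_zero).ne'
  rw [cullenPoly_eq, show (q ^ (2 * n)) ^ 2 = q ^ (4 * n) by ring,
    show q * (q ^ (2 * n)) ^ 3 = q ^ (6 * n + 1) by ring,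
    show q * q ^ (2 * n) = q ^ (2 * n + 1) by ring,
    show q ^ 2 * (q ^ (2 * n)) ^ 4 = q ^ (8 * n + 2) by ring,
    show q ^ 3 * (q ^ (2 * n)) ^ 3 = q ^ (6 * n + 3) by ring,
    show q ^ 2 * q ^ (4 * n) = q ^ (4 * n + 2) by ring]
  generalize 1 - q ^ 2 = d at *
  generalize cullenTheta (q ^ (4 * n)) (q ^ (2 * n + 1)) = t1
  generalize cullenTheta (q ^ (4 * n + 2)) (q ^ (2 * n + 1)) = t2
  generalize q ^ (4 * n) = x1
  generalize q ^ (2 * n + 1) = x2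
  generalize q ^ (6 * n + 1) = x3
  generalize q ^ (8 * n + 2) = x4
  generalize q ^ (6 * n + 3) = x5
  field_simp

theorem tendsto_zhaoPoly_div (n : ℕ) :
    Tendsto (fun q : ℝ => zhaoPoly q n / (1 - q ^ 2) ^ 4) (𝓝[<] 1)
      (𝓝 ((4528 * (n : ℝ) ^ 4 + 3180 * n ^ 3 + 972 * n ^ 2 + 147 * n + 9) / 8)) := by
  have c1 : Tendsto (fun q : ℝ => q ^ (2 * n) * (1 + q ^ (2 * n) + (q ^ (2 * n)) ^ 2)) (𝓝[<] 1)
      (𝓝 (1 ^ (2 * n) * (1 + 1 ^ (2 * n) + (1 ^ (2 * n)) ^ 2))) :=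
    Continuous.tendsto_nhdsLT_one
      (f := fun q : ℝ => q ^ (2 * n) * (1 + q ^ (2 * n) + (q ^ (2 * n)) ^ 2)) (by fun_prop)
  -- Both products in `zhaoKappa` have five vanishing factors, and 1/((1-q)(1-q²)^4) =
  -- (1+q)/(1-q²)^5; hence the extra 1 + q.
  have c2 : Tendsto (fun q : ℝ => (1 + q * q ^ (2 * n)) ^ 4 * (1 + q)) (𝓝[<] 1)
      (𝓝 ((1 + 1 * 1 ^ (2 * n)) ^ 4 * (1 + 1))) :=
    Continuous.tendsto_nhdsLT_one
      (f := fun q : ℝ => (1 + q * q ^ (2 * n)) ^ 4 * (1 + q)) (by fun_prop)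
  have c3 : Tendsto (fun q : ℝ => q * (1 + q * q ^ (2 * n))) (𝓝[<] 1)
      (𝓝 (1 * (1 + 1 * 1 ^ (2 * n)))) :=
    Continuous.tendsto_nhdsLT_one (f := fun q : ℝ => q * (1 + q * q ^ (2 * n))) (by fun_prop)
  have t := tendsto_one_sub_pow_div
  have h := ((((c1.mul (t (6 * n + 2))).mul (t (4 * n + 1))).mul (t (2 * n + 1))).mul
    (t (6 * n + 3))).sub (c2.mul ((((c3.mul (t (6 * n + 1))).mul ((t (2 * n)).pow 3)).mul
    (t (4 * n))).sub ((((t (4 * n + 1)).pow 2).mul (t (6 * n))).mul ((t (2 * n + 1)).pow 2))))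
  convert h.congr' ?_ using 2
  · push_cast
    simp only [one_pow]
    ring
  filter_upwards [eventually_mem_Ioo_nhdsLT_one] with q hq
  have h1 : 1 - q ≠ 0 := by linarith [hq.2]
  have h2 : 1 + q ≠ 0 := by linarith [hq.1]
  have hP : zhaoPoly q n = q ^ (2 * n) * (1 + q ^ (2 * n) + (q ^ (2 * n)) ^ 2) *
      (1 - q ^ (6 * n + 2)) * (1 - q ^ (4 * n + 1)) * (1 - q ^ (2 * n + 1)) *
      (1 - q ^ (6 * n + 3)) - (1 + q * q ^ (2 * n)) ^ 4 *
      (q * (1 + q * q ^ (2 * n)) * (1 - q ^ (6 * n + 1)) * (1 - q ^ (2 * n)) ^ 3 *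
        (1 - q ^ (4 * n)) - (1 - q ^ (4 * n + 1)) ^ 2 * (1 - q ^ (6 * n)) *
        (1 - q ^ (2 * n + 1)) ^ 2) / (1 - q) := by
    have := zhaoPoly_eq q n
    rw [eq_sub_iff_add_eq, add_comm, ← eq_sub_iff_add_eq, div_eq_iff h1]
    rw [zhaoKappa] at this
    linear_combination -this
  rw [hP, show 1 - q ^ 2 = (1 - q) * (1 + q) by ring]
  generalize 1 - q ^ (6 * n + 2) = x1
  generalize 1 - q ^ (4 * n + 1) = x2
  generalize 1 - q ^ (2 * n + 1) = x3
  generalize 1 - q ^ (6 * n + 3) = x4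
  generalize 1 - q ^ (6 * n + 1) = x5
  generalize 1 - q ^ (6 * n) = x6
  generalize 1 - q ^ (4 * n) = x7
  generalize 1 - q ^ (2 * n) = x8
  generalize q ^ (2 * n) * (1 + q ^ (2 * n) + (q ^ (2 * n)) ^ 2) = x9
  generalize 1 + q * q ^ (2 * n) = y1
  generalize 1 - q = y2 at *
  generalize 1 + q = y3 at *
  field_simp

theorem pow_pow_eq_pow_pow_of_eq {a b : ℝ} {i : ℕ} (h : a = b ^ i) (n : ℕ) :
    a ^ n = (b ^ n) ^ i := by
  rw [h, ← pow_mul, mul_comm, pow_mul]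

theorem tendsto_cullenQTerm_div (n : ℕ) :
    Tendsto (fun q : ℝ => cullenQTerm q n / (1 - q ^ 2) ^ 4) (𝓝[<] 1)
      (𝓝 (cullenTerm n / 2048)) := by
  have c1 : Tendsto (fun q : ℝ => q ^ (4 * n ^ 2)) (𝓝[<] 1) (𝓝 (1 ^ (4 * n ^ 2))) :=
    Continuous.tendsto_nhdsLT_one (f := fun q : ℝ => q ^ (4 * n ^ 2)) (by fun_prop)
  have c2 : Tendsto (fun q : ℝ => (q ^ (4 * n) + 1) * (q ^ (2 * n + 1) + 1) ^ 9) (𝓝[<] 1)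
      (𝓝 ((1 ^ (4 * n) + 1) * (1 ^ (2 * n + 1) + 1) ^ 9)) :=
    Continuous.tendsto_nhdsLT_one
      (f := fun q : ℝ => (q ^ (4 * n) + 1) * (q ^ (2 * n + 1) + 1) ^ 9) (by fun_prop)
  have r1 := risingFac_pos one_pos n
  have r2 := risingFac_pos (one_half_pos (α := ℝ)) n
  have hne : (1 ^ (4 * n) + 1 : ℝ) * (1 ^ (2 * n + 1) + 1) ^ 9 * risingFac 1 (2 * n) ^ 10 ≠ 0 := by
    have := risingFac_pos one_pos (2 * n)
    positivity
  have h := (((c1.mul (tendsto_cullenPoly_div n)).mul (tendsto_qPoch_base_div_pow (4 * n))).mul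
    ((tendsto_qPoch_half_div_pow n).pow 16)).div
    (c2.mul ((tendsto_qPoch_base_div_pow (2 * n)).pow 10)) hne
  convert h.congr' ?_ using 2
  · rw [cullenTerm, risingFac_one_four_mul, risingFac_one_two_mul]
    simp only [one_pow, div_pow]
    -- All geometric factors become powers of the single atom 4^n.
    rw [pow_pow_eq_pow_pow_of_eq (show (2 : ℝ) ^ 12 = 4 ^ 6 by norm_num),
      pow_pow_eq_pow_pow_of_eq (show (256 : ℝ) = 4 ^ 4 by norm_num)]
    have : (4 : ℝ) ^ n ≠ 0 := by positivity
    generalize (4 : ℝ) ^ n = z at *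
    field_simp
    ring
  filter_upwards [eventually_mem_Ioo_nhdsLT_one] with q hq
  have h1 : 1 - q ^ 2 ≠ 0 := (one_sub_pow_pos hq.1 hq.2 two_ne_zero).ne'
  have h2 : (1 - q ^ 2) ^ n ≠ 0 := pow_ne_zero _ h1
  simp only [Pi.div_apply, cullenQTerm]
  rw [mul_comm 4 n, mul_comm 2 n, pow_mul (1 - q ^ 2) n 4, pow_mul (1 - q ^ 2) n 2]
  generalize (1 - q ^ 2) ^ n = d' at *
  generalize 1 - q ^ 2 = d at *
  field_simp

theorem tendsto_zhaoQTerm_div (n : ℕ) :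
    Tendsto (fun q : ℝ => zhaoQTerm q n / (1 - q ^ 2) ^ 4) (𝓝[<] 1)
      (𝓝 (zhaoTerm n / 768)) := by
  have c1 : Tendsto (fun q : ℝ => (-1) ^ n * q ^ (n ^ 2)) (𝓝[<] 1)
      (𝓝 ((-1) ^ n * 1 ^ (n ^ 2))) :=
    Continuous.tendsto_nhdsLT_one (f := fun q : ℝ => (-1) ^ n * q ^ (n ^ 2)) (by fun_prop)
  have c2 : Tendsto (fun q : ℝ => (q ^ (2 * n) - q ^ n + 1) * (q ^ (2 * n) + q ^ n + 1) *
      (q ^ (2 * n + 1) + 1) ^ 5) (𝓝[<] 1) (𝓝 ((1 ^ (2 * n) - 1 ^ n + 1) *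
      (1 ^ (2 * n) + 1 ^ n + 1) * (1 ^ (2 * n + 1) + 1) ^ 5)) :=
    Continuous.tendsto_nhdsLT_one (f := fun q : ℝ => (q ^ (2 * n) - q ^ n + 1) *
      (q ^ (2 * n) + q ^ n + 1) * (q ^ (2 * n + 1) + 1) ^ 5) (by fun_prop)
  have r1 := risingFac_pos one_pos n
  have r2 := risingFac_pos (one_half_pos (α := ℝ)) n
  have hne : (1 ^ (2 * n) - 1 ^ n + 1 : ℝ) * (1 ^ (2 * n) + 1 ^ n + 1) *
      (1 ^ (2 * n + 1) + 1) ^ 5 * risingFac 1 n ^ 5 * risingFac 1 (2 * n) ^ 5 ≠ 0 := by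
    have := risingFac_pos one_pos (2 * n)
    simp only [one_pow]
    norm_num
    exact ⟨r1.ne', this.ne'⟩
  have h := ((((c1.mul (tendsto_zhaoPoly_div n)).mul (tendsto_qPoch_half_div_pow (2 * n))).mul
    (tendsto_qPoch_base_div_pow (3 * n))).mul ((tendsto_qPoch_half_div_pow n).pow 10)).div
    ((c2.mul ((tendsto_qPoch_base_div_pow n).pow 5)).mul
    ((tendsto_qPoch_base_div_pow (2 * n)).pow 5)) hne
  convert h.congr' ?_ using 2
  · rw [zhaoTerm, risingFac_one_three_mul, risingFac_one_two_mul, risingFac_half_two_mul]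
    simp only [one_pow]
    rw [neg_pow, div_pow, pow_pow_eq_pow_pow_of_eq (show (2 : ℝ) ^ 8 = 4 ^ 4 by norm_num),
      show (3 : ℝ) ^ 3 = 27 by norm_num]
    have : (4 : ℝ) ^ n ≠ 0 := by positivity
    generalize (4 : ℝ) ^ n = z at *
    generalize (-1 : ℝ) ^ n = s at *
    field_simp
    ring
  filter_upwards [eventually_mem_Ioo_nhdsLT_one] with q hq
  have h1 : 1 - q ^ 2 ≠ 0 := (one_sub_pow_pos hq.1 hq.2 two_ne_zero).ne'
  have h2 : (1 - q ^ 2) ^ n ≠ 0 := pow_ne_zero _ h1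
  simp only [Pi.div_apply, zhaoQTerm]
  rw [mul_comm 3 n, mul_comm 2 n, pow_mul (1 - q ^ 2) n 3, pow_mul (1 - q ^ 2) n 2]
  generalize (1 - q ^ 2) ^ n = d' at *
  generalize 1 - q ^ 2 = d at *
  generalize (-1) ^ n * q ^ n ^ 2 = s
  generalize (q ^ (n * 2) - q ^ n + 1) * (q ^ (n * 2) + q ^ n + 1) * (q ^ (n * 2 + 1) + 1) ^ 5 = t
  generalize qPoch q (q ^ 2) n = x1
  generalize qPoch q (q ^ 2) (n * 2) = x2
  generalize qPoch (q ^ 2) (q ^ 2) n = x3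
  generalize qPoch (q ^ 2) (q ^ 2) (n * 2) = x4
  generalize qPoch (q ^ 2) (q ^ 2) (n * 3) = x5
  generalize zhaoPoly q n = p
  field_simp

/-! ### The q-gamma side and Wallis' product -/

/-- The square of the ratio of `q`-shifted factorials approximating the reciprocal `q`-gamma
value is bounded above by its finite approximations. -/
theorem qPochInf_ratio_sq_le {q : ℝ} (hq0 : 0 < q) (hq : q < 1) (n : ℕ) :
    (qPochInf q (q ^ 2) / qPochInf (q ^ 2) (q ^ 2)) ^ 2 ≤
      (qPoch q (q ^ 2) n / qPoch (q ^ 2) (q ^ 2) n) ^ 2 * (1 - q ^ (2 * n + 1)) := by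
  have hQ0 : 0 < q ^ 2 := by positivity
  have hQ : q ^ 2 < 1 := pow_lt_one₀ hq0.le hq two_ne_zero
  have hL := qPochInf_pos hQ0 hQ hQ0 hQ
  have hanti : Antitone fun n => (qPoch q (q ^ 2) n / qPoch (q ^ 2) (q ^ 2) n) ^ 2 *
      (1 - q ^ (2 * n + 1)) := by
    refine antitone_nat_of_succ_le fun m => ?_
    have h0 := (qPoch_pos hQ0 hQ hQ0 hQ m).ne'
    have h1 : 0 < 1 - q ^ (2 * m + 1) := one_sub_pow_pos hq0 hq (by omega)
    have h2 : 0 < 1 - q ^ (2 * m + 2) := one_sub_pow_pos hq0 hq (by omega)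
    -- The difference of the two sides is q^(2m+1) (1 - q)².
    have h3 : (1 - q ^ (2 * m + 1)) * (1 - q ^ (2 * m + 3)) ≤ (1 - q ^ (2 * m + 2)) ^ 2 := by
      have : 0 < q ^ (2 * m + 1) := by positivity
      rw [pow_succ q (2 * m + 2), pow_succ q (2 * m + 1)]
      nlinarith [mul_nonneg this.le (sq_nonneg (1 - q))]
    have e : (qPoch q (q ^ 2) (m + 1) / qPoch (q ^ 2) (q ^ 2) (m + 1)) ^ 2 *
        (1 - q ^ (2 * (m + 1) + 1)) = (qPoch q (q ^ 2) m / qPoch (q ^ 2) (q ^ 2) m) ^ 2 *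
        (1 - q ^ (2 * m + 1)) *
          ((1 - q ^ (2 * m + 1)) * (1 - q ^ (2 * m + 3)) / (1 - q ^ (2 * m + 2)) ^ 2) := by
      rw [qPoch_succ, qPoch_succ, ← pow_mul, ← pow_succ', ← pow_add, add_comm 2 (2 * m),
        show 2 * (m + 1) + 1 = 2 * m + 3 by ring]
      field_simp
    rw [e]
    exact mul_le_of_le_one_right (by positivity) (div_le_one_of_le₀ h3 (by positivity))
  refine hanti.le_of_tendsto ?_ n
  have h := ((tendsto_qPoch q hQ0 hQ).div (tendsto_qPoch (q ^ 2) hQ0 hQ) hL.ne').pow 2 |>.mul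
    (((tendsto_pow_two_mul hq0 hq).mul_const q).const_sub 1)
  simpa [pow_succ] using h

/-- The companion lower bound to `qPochInf_ratio_sq_le`. -/
theorem le_qPochInf_ratio_sq {q : ℝ} (hq0 : 0 < q) (hq : q < 1) (n : ℕ) :
    (qPoch q (q ^ 2) n / qPoch (q ^ 2) (q ^ 2) n) ^ 2 * (1 - q ^ (2 * n)) ≤
      (qPochInf q (q ^ 2) / qPochInf (q ^ 2) (q ^ 2)) ^ 2 := by
  have hQ0 : 0 < q ^ 2 := by positivity
  have hQ : q ^ 2 < 1 := pow_lt_one₀ hq0.le hq two_ne_zero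
  have hL := qPochInf_pos hQ0 hQ hQ0 hQ
  have hmono : Monotone fun n => (qPoch q (q ^ 2) n / qPoch (q ^ 2) (q ^ 2) n) ^ 2 *
      (1 - q ^ (2 * n)) := by
    refine monotone_nat_of_le_succ fun m => ?_
    have h0 := (qPoch_pos hQ0 hQ hQ0 hQ m).ne'
    have h2 : 0 < 1 - q ^ (2 * m + 2) := one_sub_pow_pos hq0 hq (by omega)
    -- The difference of the two sides is q^(2m) (1 - q)².
    have h3 : (1 - q ^ (2 * m)) * (1 - q ^ (2 * m + 2)) ≤ (1 - q ^ (2 * m + 1)) ^ 2 := by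
      have : 0 < q ^ (2 * m) := by positivity
      rw [pow_succ q (2 * m + 1), pow_succ q (2 * m)]
      nlinarith [mul_nonneg this.le (sq_nonneg (1 - q))]
    have e : (qPoch q (q ^ 2) (m + 1) / qPoch (q ^ 2) (q ^ 2) (m + 1)) ^ 2 *
        (1 - q ^ (2 * (m + 1))) = (qPoch q (q ^ 2) m / qPoch (q ^ 2) (q ^ 2) m) ^ 2 *
        ((1 - q ^ (2 * m + 1)) ^ 2 / (1 - q ^ (2 * m + 2))) := by
      rw [qPoch_succ, qPoch_succ, ← pow_mul, ← pow_succ', ← pow_add, add_comm 2 (2 * m),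
        show 2 * (m + 1) = 2 * m + 2 by ring]
      field_simp
    simp only [e]
    gcongr
    rwa [le_div_iff₀ h2]
  refine hmono.ge_of_tendsto ?_ n
  have h := ((tendsto_qPoch q hQ0 hQ).div (tendsto_qPoch (q ^ 2) hQ0 hQ) hL.ne').pow 2 |>.mul
    ((tendsto_pow_two_mul hq0 hq).const_sub 1)
  simpa using h

theorem risingFac_half_sq_mul_wallis (n : ℕ) :
    risingFac (1 / 2) n ^ 2 * (n + 1 / 2) * (2 * Real.Wallis.W n) = risingFac 1 n ^ 2 := by
  induction n with
  | zero => simp [risingFac_zero, Real.Wallis.W]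
  | succ n ih =>
    rw [risingFac_succ, risingFac_succ, Real.Wallis.W_succ, mul_pow _ ((1 : ℝ) + n), ← ih]
    push_cast
    field_simp
    ring

theorem tendsto_risingFac_ratio_sq_mul :
    Tendsto (fun n : ℕ => (risingFac (1 / 2) n / risingFac 1 n) ^ 2 * ((n : ℝ) + 1 / 2)) atTop
      (𝓝 (1 / Real.pi)) := by
  have h := (Real.Wallis.tendsto_W_nhds_pi_div_two.const_mul 2).inv₀
    (by have := Real.pi_pos; positivity)
  rw [mul_div_cancel₀ _ (two_ne_zero : (2 : ℝ) ≠ 0), ← one_div] at h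
  refine h.congr fun n => ?_
  have h1 := (risingFac_pos one_pos n).ne'
  have h2 := (Real.Wallis.W_pos n).ne'
  have h3 := risingFac_half_sq_mul_wallis n
  rw [div_pow, ← h3]
  have h4 := (risingFac_pos (one_half_pos (α := ℝ)) n).ne'
  have h5 : (n : ℝ) + 1 / 2 ≠ 0 := by positivity
  generalize (n : ℝ) + 1 / 2 = z at *
  field_simp

/-- The finite bounds hold for every n and q. At fixed n they tend, as q → 1, to ((1/2)_n/n!)² times
n or n + 1/2, and both tend to 1/π as n grows. Fixing n before q → 1 avoids any uniformity or
interchange of limits. -/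
theorem tendsto_qPochInf_ratio_sq_div :
    Tendsto (fun q : ℝ => (qPochInf q (q ^ 2) / qPochInf (q ^ 2) (q ^ 2)) ^ 2 / (1 - q ^ 2))
      (𝓝[<] 1) (𝓝 (1 / Real.pi)) := by
  have hn := tendsto_risingFac_ratio_sq_mul
  have hn' : Tendsto (fun n : ℕ => (risingFac (1 / 2) n / risingFac 1 n) ^ 2 * (n : ℝ)) atTop
      (𝓝 (1 / Real.pi)) := by
    have h := hn.mul (tendsto_natCast_div_add_atTop (1 / 2 : ℝ))
    rw [mul_one] at h
    refine h.congr fun n => ?_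
    have : (n : ℝ) + 1 / 2 ≠ 0 := by positivity
    rw [mul_assoc, mul_div_cancel₀ _ this]
  have hfin : ∀ n j : ℕ, Tendsto (fun q : ℝ => (qPoch q (q ^ 2) n / qPoch (q ^ 2) (q ^ 2) n) ^ 2 *
      (1 - q ^ j) / (1 - q ^ 2)) (𝓝[<] 1)
      (𝓝 ((risingFac (1 / 2) n / risingFac 1 n) ^ 2 * ((j : ℝ) / 2))) := by
    intro n j
    have h := (((tendsto_qPoch_half_div_pow n).div (tendsto_qPoch_base_div_pow n)
      (risingFac_pos one_pos n).ne').pow 2).mul (tendsto_one_sub_pow_div j)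
    refine h.congr' ?_
    filter_upwards [eventually_mem_Ioo_nhdsLT_one] with q hq
    have h1 : (1 - q ^ 2) ^ n ≠ 0 := pow_ne_zero _ (one_sub_pow_pos hq.1 hq.2 two_ne_zero).ne'
    simp only [Pi.div_apply]
    rw [div_div_div_cancel_right₀ h1, mul_div_assoc]
  rw [tendsto_order]
  refine ⟨fun x hx => ?_, fun x hx => ?_⟩
  · obtain ⟨n, hxn⟩ := (hn'.eventually (lt_mem_nhds hx)).exists
    have h := hfin n (2 * n)
    rw [Nat.cast_mul, Nat.cast_two, mul_div_cancel_left₀ _ (two_ne_zero : (2 : ℝ) ≠ 0)] at h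
    filter_upwards [h.eventually (lt_mem_nhds hxn), eventually_mem_Ioo_nhdsLT_one] with q h1 hq
    have h2 := one_sub_pow_pos hq.1 hq.2 two_ne_zero
    exact h1.trans_le (div_le_div_of_nonneg_right (le_qPochInf_ratio_sq hq.1 hq.2 n) h2.le)
  · obtain ⟨n, hxn⟩ := (hn.eventually (gt_mem_nhds hx)).exists
    have h := hfin n (2 * n + 1)
    rw [show ((2 * n + 1 : ℕ) : ℝ) / 2 = n + 1 / 2 by push_cast; ring] at h
    filter_upwards [h.eventually (gt_mem_nhds hxn), eventually_mem_Ioo_nhdsLT_one] with q h1 hq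
    have h2 := one_sub_pow_pos hq.1 hq.2 two_ne_zero
    exact (div_le_div_of_nonneg_right (qPochInf_ratio_sq_le hq.1 hq.2 n) h2.le).trans_lt h1

theorem tendsto_qGamma_side :
    Tendsto (fun q : ℝ => (1 - q ^ 2) ^ 4 / qGamma (q ^ 2) (1 / 2) ^ 8 / (1 - q ^ 2) ^ 4)
      (𝓝[<] 1) (𝓝 (1 / Real.pi ^ 4)) := by
  have h := tendsto_qPochInf_ratio_sq_div.pow 4
  rw [div_pow, one_pow] at h
  refine h.congr' ?_
  filter_upwards [eventually_mem_Ioo_nhdsLT_one] with q hq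
  rw [one_sub_pow_div_qGamma_half hq.1 hq.2, div_pow, ← pow_mul]

/-- The two `q`-series evaluations for `0 < q < 1`, together with the fact that, after division by
`(1 - q²)⁴`, both sides tend (the sums term by term) to Cullen's and Zhao's formulas for `1 / π⁴`
as `q → 1⁻`. -/
theorem mainTheorem4 :
    (∀ q : ℝ, 0 < q → q < 1 →
      HasSum (cullenQTerm q) ((1 - q ^ 2) ^ 4 / qGamma (q ^ 2) (1 / 2) ^ 8) ∧
      HasSum (zhaoQTerm q) ((1 - q ^ 2) ^ 4 / qGamma (q ^ 2) (1 / 2) ^ 8)) ∧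
    (∀ n : ℕ, Tendsto (fun q : ℝ => cullenQTerm q n / (1 - q ^ 2) ^ 4) (𝓝[<] 1)
      (𝓝 (cullenTerm n / 2048))) ∧
    (∀ n : ℕ, Tendsto (fun q : ℝ => zhaoQTerm q n / (1 - q ^ 2) ^ 4) (𝓝[<] 1)
      (𝓝 (zhaoTerm n / 768))) ∧
    Tendsto (fun q : ℝ => (1 - q ^ 2) ^ 4 / qGamma (q ^ 2) (1 / 2) ^ 8 / (1 - q ^ 2) ^ 4)
      (𝓝[<] 1) (𝓝 (1 / Real.pi ^ 4)) :=
  ⟨fun _ hq0 hq => ⟨hasSum_cullenQTerm hq0 hq, hasSum_zhaoQTerm hq0 hq⟩,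
    tendsto_cullenQTerm_div, tendsto_zhaoQTerm_div, tendsto_qGamma_side⟩
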